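/- Let $\mathbf U=\{z=x+is:\ x\in\mathbb R,\ s>0\}$ and let $\alpha>0$ be real. Let $H^2(\mathbf U)$ be the Hardy space of analytic functions $f$ on $\mathbf U$ with $$\|f\|_{H^2}^2=\sup_{s>0}\int_{-\infty}^{\infty}|f(x+is)|^2\,dx<\infty ,$$ and let $A_{2\alpha+1}(\mathbf U)$ be the weighted Bergman space of analytic functions $F$ on $\mathbf U$ with $$\|F\|_{A_{2\alpha+1}}^2=\iint_{\mathbf U}|F(x+is)|^2\,s^{2\alpha-1}\,dx\,ds<\infty .$$ For every $f\in H^2(\mathbf U)$ the functions $f(\cdot+is)$ converge in $L^2(\mathbb R)$, as $s\to0^+$, to a boundary function, again denoted $f$. Let $\mathcal F$ be the unitary Fourier transform on $L^2(\mathbb R)$, that is, the continuous extension of $(\mathcal Ff)(t)=\frac1{\sqrt{2\pi}}\int_{-\infty}^{\infty}e^{-itx}f(x)\,dx$. For every $f\in H^2(\mathbf U)$ and $z\in\mathbf U$ the integral $$\mathrm{Ber}^{\alpha}f(z)=\int_0^\infty t^{\alpha}e^{izt}(\mathcal Ff)(t)\,dt$$ converges absolutely. Up to the normalization of the norms, the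 Bergman transform $\mathrm{Ber}^\alpha$ is an isometric isomorphism of $H^2(\mathbf U)$ onto $A_{2\alpha+1}(\mathbf U)$. Precisely, with $$K_\alpha=\frac{2\pi\,\Gamma(2\alpha)}{4^{\alpha}},$$ the map $K_\alpha^{-1/2}\,\mathrm{Ber}^{\alpha}$ is a linear isometric bijection of $H^2(\mathbf U)$ onto $A_{2\alpha+1}(\mathbf U)$. Equivalently, $\mathrm{Ber}^\alpha$ is a linear bijection of $H^2(\mathbf U)$ onto $A_{2\alpha+1}(\mathbf U)$ and $\|\mathrm{Ber}^\alpha f\|_{A_{2\alpha+1}}^2=K_\alpha\|f\|_{H^2}^2$ for all $f\in H^2(\mathbf U)$, so that $\mathrm{Ber}^\alpha$ itself is an isometric isomorphism when $A_{2\alpha+1}(\mathbf U)$ carries the normalized norm $K_\alpha^{-1/2}\|\cdot\|_{A_{2\alpha+1}}$. -/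

import Mathlib

open MeasureTheory Filter Topology FourierTransform
open scoped UpperHalfPlane Manifold ENNReal

noncomputable section

namespace BergmanTransform

/-! ### The Hardy space of the upper half-plane -/

/-- The point `x + i s` of the upper half-plane, for real `x` and `s > 0`. -/
def point (x : ℝ) (s : Set.Ioi (0 : ℝ)) : ℍ :=
  ⟨(x : ℂ) + (s : ℝ) * Complex.I, by have h : (0 : ℝ) < s := s.2; simpa using h⟩

/-- The restriction `x ↦ f (x + i s)` of `f` to the horizontal line at height `s`. -/
def slice (f : ℍ → ℂ) (s : Set.Ioi (0 : ℝ)) : ℝ → ℂ := fun x => f (point x s)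

/-- `sup_{s > 0} (∫ |f (x + i s)|² dx)^{1/2}`, as an extended nonnegative number. -/
def hardyENorm (f : ℍ → ℂ) : ℝ≥0∞ :=
  ⨆ s : Set.Ioi (0 : ℝ), eLpNorm (slice f s) 2 volume

lemma continuous_slice {f : ℍ → ℂ} (hf : Continuous f) (s : Set.Ioi (0 : ℝ)) :
    Continuous (slice f s) := by
  refine hf.comp ?_
  rw [UpperHalfPlane.isEmbedding_coe.continuous_iff]
  change Continuous fun x : ℝ => (x : ℂ) + (s : ℝ) * Complex.I
  fun_prop

lemma hardyENorm_add_le {f g : ℍ → ℂ} (hf : Continuous f) (hg : Continuous g) :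
    hardyENorm (f + g) ≤ hardyENorm f + hardyENorm g := by
  refine iSup_le fun s => ?_
  have h : eLpNorm (slice f s + slice g s) 2 volume
      ≤ eLpNorm (slice f s) 2 volume + eLpNorm (slice g s) 2 volume :=
    eLpNorm_add_le (continuous_slice hf s).aestronglyMeasurable
      (continuous_slice hg s).aestronglyMeasurable (by norm_num)
  refine le_trans h (add_le_add ?_ ?_)
  · exact le_iSup (fun s => eLpNorm (slice f s) 2 volume) s
  · exact le_iSup (fun s => eLpNorm (slice g s) 2 volume) s

lemma hardyENorm_smul (c : ℂ) (f : ℍ → ℂ) :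
    hardyENorm (c • f) = ‖c‖ₑ * hardyENorm f := by
  rw [hardyENorm, hardyENorm, ENNReal.mul_iSup]
  exact iSup_congr fun s => eLpNorm_const_smul c (slice f s) 2 volume

lemma hardyENorm_zero : hardyENorm (0 : ℍ → ℂ) = 0 := by
  have h := hardyENorm_smul 0 (0 : ℍ → ℂ)
  simpa using h

/-- The Hardy space `H²(U)`: holomorphic functions on the upper half-plane whose `L²` norms on
horizontal lines are uniformly bounded. -/
def HardySpace : Submodule ℂ (ℍ → ℂ) where
  carrier := {f | MDifferentiable 𝓘(ℂ) 𝓘(ℂ) f ∧ hardyENorm f < ∞}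
  add_mem' := fun hf hg => ⟨hf.1.add hg.1,
    (hardyENorm_add_le hf.1.continuous hg.1.continuous).trans_lt
      (ENNReal.add_lt_top.2 ⟨hf.2, hg.2⟩)⟩
  zero_mem' := ⟨mdifferentiable_const, by rw [hardyENorm_zero]; exact ENNReal.zero_lt_top⟩
  smul_mem' := fun c f hf => ⟨hf.1.const_smul c, by
    rw [hardyENorm_smul]; exact ENNReal.mul_lt_top enorm_lt_top hf.2⟩

lemma HardySpace.continuous (f : HardySpace) : Continuous (f : ℍ → ℂ) := f.2.1.continuous

lemma HardySpace.memLp_slice (f : HardySpace) (s : Set.Ioi (0 : ℝ)) :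
    MemLp (slice f s) 2 volume :=
  ⟨(continuous_slice (HardySpace.continuous f) s).aestronglyMeasurable,
    (le_iSup (fun s => eLpNorm (slice f s) 2 volume) s).trans_lt f.2.2⟩

lemma HardySpace.eq_zero_of_norm (f : HardySpace)
    (h : (hardyENorm (f : ℍ → ℂ)).toReal = 0) : f = 0 := by
  have h0 : hardyENorm (f : ℍ → ℂ) = 0 :=
    ((ENNReal.toReal_eq_zero_iff _).1 h).resolve_right f.2.2.ne
  ext z
  let s : Set.Ioi (0 : ℝ) := ⟨z.im, z.im_pos⟩
  have hs : eLpNorm (slice f s) 2 volume = 0 := by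
    have := le_iSup (fun s => eLpNorm (slice f s) 2 volume) s
    exact le_antisymm (this.trans h0.le) bot_le
  have hae := (eLpNorm_eq_zero_iff
    (continuous_slice (HardySpace.continuous f) s).aestronglyMeasurable (by norm_num)).1 hs
  have heq := (continuous_slice (HardySpace.continuous f) s).ae_eq_iff_eq volume continuous_zero |>.1 hae
  have hz : point z.re s = z := by
    apply UpperHalfPlane.ext
    exact Complex.re_add_im (z : ℂ)
  have := congrFun heq z.re
  simpa [slice, hz] using this

/-- The norm `‖f‖ = sup_{s > 0} (∫ |f (x + i s)|² dx)^{1/2}` on `H²(U)`. -/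
instance : NormedAddCommGroup HardySpace :=
  AddGroupNorm.toNormedAddCommGroup
    { toFun := fun f => (hardyENorm (f : ℍ → ℂ)).toReal
      map_zero' := by
        change (hardyENorm (0 : ℍ → ℂ)).toReal = 0
        rw [hardyENorm_zero, ENNReal.toReal_zero]
      add_le' := fun f g => by
        rw [← ENNReal.toReal_add f.2.2.ne g.2.2.ne]
        exact ENNReal.toReal_mono (ENNReal.add_lt_top.2 ⟨f.2.2, g.2.2⟩).ne
          (hardyENorm_add_le (HardySpace.continuous f) (HardySpace.continuous g))
      neg' := fun f => by
        have h := hardyENorm_smul (-1) (f : ℍ → ℂ)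
        rw [neg_one_smul] at h
        change (hardyENorm (-(f : ℍ → ℂ))).toReal = _
        rw [h]
        simp
      eq_zero_of_map_eq_zero' := fun f h => HardySpace.eq_zero_of_norm f h }

instance : NormedSpace ℂ HardySpace where
  norm_smul_le := fun c f => by
    change (hardyENorm (c • (f : ℍ → ℂ))).toReal ≤ ‖c‖ * (hardyENorm (f : ℍ → ℂ)).toReal
    rw [hardyENorm_smul, ENNReal.toReal_mul, toReal_enorm]

/-! ### The weighted Bergman spaces of the upper half-plane -/

/-- The measure `s ^ (β - 2) dx ds` on the upper half-plane, where `z = x + i s`. -/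
def bergmanMeasure (β : ℝ) : Measure ℍ :=
  (Measure.comap UpperHalfPlane.coe volume).withDensity fun z => ENNReal.ofReal (z.im ^ (β - 2))

/-- The weighted Bergman space `A_β(U)`: holomorphic functions on the upper half-plane that are
square integrable with respect to `s ^ (β - 2) dx ds`. -/
def BergmanSpace (β : ℝ) : Submodule ℂ (ℍ → ℂ) where
  carrier := {f | MDifferentiable 𝓘(ℂ) 𝓘(ℂ) f ∧ MemLp f 2 (bergmanMeasure β)}
  add_mem' := fun hf hg => ⟨hf.1.add hg.1, hf.2.add hg.2⟩
  zero_mem' := ⟨mdifferentiable_const, MemLp.zero⟩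
  smul_mem' := fun c _ hf => ⟨hf.1.const_smul c, hf.2.const_smul c⟩

/-- The class in `L²` of a function in the Bergman space. -/
def BergmanSpace.toL2 (β : ℝ) : BergmanSpace β →ₗ[ℂ] Lp ℂ 2 (bergmanMeasure β) where
  toFun := fun f => f.2.2.toLp f
  map_add' := fun f g => f.2.2.toLp_add g.2.2
  map_smul' := fun c f => f.2.2.toLp_const_smul c

lemma comap_absolutelyContinuous (β : ℝ) :
    Measure.comap UpperHalfPlane.coe volume ≪ bergmanMeasure β := by
  refine withDensity_absolutelyContinuous' ?_ ?_
  · have : Measurable fun z : ℍ => z.im := UpperHalfPlane.continuous_im.measurable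
    exact (this.pow_const _).ennreal_ofReal.aemeasurable
  · refine Eventually.of_forall fun z => ?_
    have := Real.rpow_pos_of_pos z.im_pos (β - 2)
    simpa using this

instance : (Measure.comap UpperHalfPlane.coe (volume : Measure ℂ)).IsOpenPosMeasure where
  open_pos := fun V hV hne => by
    rw [UpperHalfPlane.measurableEmbedding_coe.comap_apply]
    exact ((UpperHalfPlane.isOpenEmbedding_coe.isOpenMap V hV).measure_pos volume
      (hne.image _)).ne'

lemma BergmanSpace.toL2_injective (β : ℝ) : Function.Injective (BergmanSpace.toL2 β) := by
  intro f g h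
  have hae : (f : ℍ → ℂ) =ᵐ[bergmanMeasure β] g := (f.2.2.toLp_eq_toLp_iff g.2.2).1 h
  have hae' := (comap_absolutelyContinuous β).ae_eq hae
  exact Subtype.ext ((f.2.1.continuous.ae_eq_iff_eq _ g.2.1.continuous).1 hae')

/-- The norm `‖F‖ = (∬ |F z|² s ^ (β - 2) dx ds)^{1/2}` on `A_β(U)`. -/
instance (β : ℝ) : NormedAddCommGroup (BergmanSpace β) :=
  NormedAddCommGroup.induced _ _ (BergmanSpace.toL2 β) (BergmanSpace.toL2_injective β)

instance (β : ℝ) : NormedSpace ℂ (BergmanSpace β) :=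
  NormedSpace.induced _ _ _ (BergmanSpace.toL2 β)

/-! ### The Bergman transform -/

/-- The filter `s → 0⁺` on the positive reals. -/
def heightToZero : Filter (Set.Ioi (0 : ℝ)) := comap Subtype.val (𝓝 0)

/-- The restriction of `f ∈ H²(U)` to the horizontal line at height `s`, in `L²(ℝ)`. -/
def sliceL2 (f : HardySpace) (s : Set.Ioi (0 : ℝ)) : Lp ℂ 2 (volume : Measure ℝ) :=
  (HardySpace.memLp_slice f s).toLp _

/-- The boundary function of `f ∈ H²(U)`: the limit in `L²(ℝ)` of `f (· + i s)` as `s → 0⁺`. -/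
def boundary (f : HardySpace) : Lp ℂ 2 (volume : Measure ℝ) :=
  haveI : Nonempty (Lp ℂ 2 (volume : Measure ℝ)) := ⟨0⟩
  limUnder heightToZero (sliceL2 f)

/-- The unitary Fourier transform on `L²(ℝ)`, the extension of
`t ↦ (2π)^{-1/2} ∫ e^{-itx} g x dx`. Mathlib's `𝓕` is the extension of `ξ ↦ ∫ e^{-2πiξx} g x dx`,
hence the rescaling. -/
def unitaryFourier (g : Lp ℂ 2 (volume : Measure ℝ)) (t : ℝ) : ℂ :=
  ((Real.sqrt (2 * Real.pi))⁻¹ : ℝ) * (𝓕 g : Lp ℂ 2 (volume : Measure ℝ)) (t / (2 * Real.pi))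

/-- The integrand `t^α e^{izt} (ℱ f)(t)` of the Bergman transform. -/
def berIntegrand (α : ℝ) (f : HardySpace) (z : ℍ) (t : ℝ) : ℂ :=
  ((t ^ α : ℝ) : ℂ) * Complex.exp (Complex.I * z * t) * unitaryFourier (boundary f) t

/-- The Bergman transform `Ber^α f (z) = ∫_0^∞ t^α e^{izt} (ℱ f)(t) dt`. -/
def Ber (α : ℝ) (f : HardySpace) (z : ℍ) : ℂ :=
  ∫ t in Set.Ioi (0 : ℝ), berIntegrand α f z t

end BergmanTransform

end

noncomputable section

namespace BergmanTransform

/-! Everything is moved to the Fourier side. For `h` vanishing on `ξ ≤ 0`, the restriction of `lap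
h` to height `s` is the inverse Fourier transform of `damp s h`, so Plancherel computes its norm on
every horizontal line.

Letting `s → 0` shows that the Hardy norm of `lap h` is the `L²` norm of `h` and, when that is
finite, that the boundary function is `𝓕⁻ h`. The substitution `t = 2πξ` then gives `Ber α (lap h) =
lap (berSymbol α h)`: the transform is multiplication by a constant times `ξ ^ α`. Integrating
Plancherel over `s` against `s ^ (2α - 1)` yields a Gamma integral proportional to `ξ ^ (-2α)`,
which cancels the square of the multiplier and leaves the constant `berConst α`.

It remains to represent both spaces by `lap`. One Paley-Wiener theorem, `exists_isLaplaceL2`, serves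
both: it only asks that `y⁻² ∫ |G(x + iy)|² dx` be integrable over `y > a` for each `a > 0`. A
contour shift (`damp_fourier_line`) shows that all lines come from a single function on the Fourier
side, and `ae_eq_zero_of_lintegral_damp` shows that this function vanishes for `ξ < 0`. Surjectivity
follows by dividing by the multiplier. -/

/-! ### The Fourier transform on `L¹ ∩ L²`, and a contour shift -/

lemma continuous_fourier_of_integrable {f : ℝ → ℂ} (hf : Integrable f) : Continuous (𝓕 f) :=
  VectorFourier.fourierIntegral_continuous Real.continuous_fourierChar
    (by exact continuous_inner) hf

/-- Both sides have the same integrals against smooth compactly supported functions: the `L²`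
transform agrees with the distributional one, and the integral satisfies the multiplication formula
`∫ Ĝ f = ∫ G f̂`. -/
lemma coeFn_fourier_toLp {f : ℝ → ℂ} (h1 : Integrable f) (h2 : MemLp f 2) :
    (𝓕 (h2.toLp f) : Lp ℂ 2 (volume : Measure ℝ)) =ᵐ[volume] 𝓕 f := by
  refine ae_eq_of_integral_contDiff_smul_eq
    ((Lp.memLp _).locallyIntegrable (by norm_num))
    (continuous_fourier_of_integrable h1).locallyIntegrable fun g hg hgs => ?_
  have hgs' : HasCompactSupport fun x => (g x : ℂ) := hgs.comp_left (g := ((↑) : ℝ → ℂ)) rfl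
  let G : SchwartzMap ℝ ℂ := hgs'.toSchwartzMap (Complex.ofRealCLM.contDiff.comp hg)
  have hG : ∀ x, G x = (g x : ℂ) := fun x => rfl
  have key := congrArg (fun T => T G) (Lp.fourier_toTemperedDistribution_eq (h2.toLp f))
  simp only [TemperedDistribution.fourier_apply, Lp.toTemperedDistribution_apply] at key
  have e1 : ∀ (u : ℝ → ℂ), ∫ x, g x • u x = ∫ x, G x • u x := fun u => by
    simp [hG]
  rw [e1, e1, ← key]
  have e2 := VectorFourier.integral_fourierIntegral_smul_eq_flip (L := innerₗ ℝ) (μ := volume)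
    (ν := volume) Real.continuous_fourierChar continuous_inner G.integrable h1
  have e3 : ∫ x, (𝓕 G) x • (h2.toLp f : ℝ → ℂ) x = ∫ x, (𝓕 G) x • f x := by
    refine integral_congr_ae ?_
    filter_upwards [h2.coeFn_toLp] with x hx
    rw [hx]
  rw [e3]
  rw [flip_innerₗ] at e2
  exact e2

lemma continuous_fourierInv_of_integrable {f : ℝ → ℂ} (hf : Integrable f) : Continuous (𝓕⁻ f) :=
  VectorFourier.fourierIntegral_continuous (L := -innerₗ ℝ) Real.continuous_fourierChar
    (by exact continuous_inner.neg) hf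

lemma coeFn_fourierInv_toLp {f : ℝ → ℂ} (h1 : Integrable f) (h2 : MemLp f 2) :
    (𝓕⁻ (h2.toLp f) : Lp ℂ 2 (volume : Measure ℝ)) =ᵐ[volume] 𝓕⁻ f := by
  refine ae_eq_of_integral_contDiff_smul_eq
    ((Lp.memLp _).locallyIntegrable (by norm_num))
    (continuous_fourierInv_of_integrable h1).locallyIntegrable fun g hg hgs => ?_
  have hgs' : HasCompactSupport fun x => (g x : ℂ) := hgs.comp_left (g := ((↑) : ℝ → ℂ)) rfl
  let G : SchwartzMap ℝ ℂ := hgs'.toSchwartzMap (Complex.ofRealCLM.contDiff.comp hg)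
  have hG : ∀ x, G x = (g x : ℂ) := fun x => rfl
  have key := congrArg (fun T => T G) (Lp.fourierInv_toTemperedDistribution_eq (h2.toLp f))
  simp only [TemperedDistribution.fourierInv_apply, Lp.toTemperedDistribution_apply] at key
  have e1 : ∀ (u : ℝ → ℂ), ∫ x, g x • u x = ∫ x, G x • u x := fun u => by
    simp [hG]
  rw [e1, e1, ← key]
  have e2 := VectorFourier.integral_fourierIntegral_smul_eq_flip (L := -innerₗ ℝ) (μ := volume)
    (ν := volume) Real.continuous_fourierChar continuous_inner.neg G.integrable h1
  have e3 : ∫ x, (𝓕⁻ G) x • (h2.toLp f : ℝ → ℂ) x = ∫ x, (𝓕⁻ G) x • f x := by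
    refine integral_congr_ae ?_
    filter_upwards [h2.coeFn_toLp] with x hx
    rw [hx]
  rw [e3]
  have hflip : (-innerₗ ℝ : ℝ →ₗ[ℝ] ℝ →ₗ[ℝ] ℝ).flip = -innerₗ ℝ := by
    ext; simp
  rw [hflip] at e2
  have e4 : ∀ ξ, (𝓕⁻ G) ξ
      = VectorFourier.fourierIntegral Real.fourierChar volume (-innerₗ ℝ) G ξ := fun ξ => by
    rw [SchwartzMap.fourierInv_coe]; rfl
  simp only [e4]
  exact e2

/-- Horizontal integrals of a holomorphic function that is integrable on a strip agree. -/
lemma integral_horizontal_eq {G : ℂ → ℂ} {a b : ℝ} (ha : 0 < a) (hab : a ≤ b)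
    (hG : DifferentiableOn ℂ G {z | 0 < z.im})
    (hs : Integrable (fun p : ℝ × ℝ => G (p.1 + p.2 * Complex.I))
      (volume.prod (volume.restrict (Set.Ioc a b))))
    (h1 : Integrable fun x : ℝ => G (x + a * Complex.I))
    (h2 : Integrable fun x : ℝ => G (x + b * Complex.I)) :
    ∫ x : ℝ, G (x + a * Complex.I) = ∫ x : ℝ, G (x + b * Complex.I) := by
  -- The contribution of a vertical side of the rectangle. By Fubini it is integrable in `x`, which
  -- replaces any pointwise decay of `G`.
  set V : ℝ → ℂ := fun x => ∫ y in a..b, G (x + y * Complex.I) with hV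
  have hVi : Integrable V := by
    simp only [hV, intervalIntegral.integral_of_le hab]
    exact hs.integral_prod_left
  have hrect : ∀ R : ℝ, 0 < R → (∫ x in -R..R, G (x + a * Complex.I))
      - (∫ x in -R..R, G (x + b * Complex.I)) = Complex.I * (V (-R) - V R) := by
    intro R hR
    have h := Complex.integral_boundary_rect_eq_zero_of_differentiableOn G
      (-R + a * Complex.I) (R + b * Complex.I) (hG.mono ?_)
    · simp only [Complex.add_re, Complex.neg_re, Complex.ofReal_re, Complex.mul_re, Complex.I_re,
        mul_zero, Complex.ofReal_im, Complex.I_im, mul_one, sub_self, add_zero, Complex.add_im,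
        Complex.neg_im, neg_zero, Complex.mul_im, zero_add, smul_eq_mul] at h
      simp only [hV]
      linear_combination h
    · rintro z ⟨-, hz⟩
      simp only [Set.mem_preimage, Complex.add_im, Complex.neg_im, Complex.ofReal_im, neg_zero,
        Complex.mul_im, Complex.ofReal_re, Complex.I_im, mul_one, Complex.I_re, mul_zero, add_zero,
        zero_add, Set.uIcc_of_le hab] at hz
      exact ha.trans_le hz.1
  have hlim := (intervalIntegral_tendsto_integral h1 tendsto_neg_atTop_atBot tendsto_id).sub
    (intervalIntegral_tendsto_integral h2 tendsto_neg_atTop_atBot tendsto_id)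
  have hlim' : Tendsto (fun R => Complex.I * (V (-R) - V R)) atTop
      (𝓝 ((∫ x : ℝ, G (x + a * Complex.I)) - ∫ x : ℝ, G (x + b * Complex.I))) := by
    refine hlim.congr' ?_
    filter_upwards [eventually_gt_atTop 0] with R hR using hrect R hR
  -- A function integrable near infinity that has a limit there can only tend to `0`.
  refine sub_eq_zero.1 (IntegrableAtFilter.eq_zero_of_tendsto (μ := volume)
    (Integrable.integrableAtFilter ((hVi.comp_neg.sub hVi).const_mul _) _) ?_ hlim')
  intro s hs
  obtain ⟨c, hc⟩ := mem_atTop_sets.1 hs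
  exact eq_top_mono (measure_mono (show Set.Ici c ⊆ s from hc)) Real.volume_Ici

/-! ### Damped functions and their Fourier-Laplace transforms -/

/-- The function `h` damped by the factor `e^{-2πsξ}`. -/
def damp (s : ℝ) (h : ℝ → ℂ) (ξ : ℝ) : ℂ := (Real.exp (-2 * Real.pi * s * ξ) : ℂ) * h ξ

/-- Functions on the positive half-line all of whose exponential dampings are in `L²`. -/
structure IsLaplaceL2 (h : ℝ → ℂ) : Prop where
  eq_zero : ∀ ξ ≤ 0, h ξ = 0
  memLp : ∀ s > 0, MemLp (damp s h) 2 volume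

/-- The Fourier-Laplace transform `z ↦ ∫ e^{2πizξ} h ξ dξ`. -/
def lap (h : ℝ → ℂ) (z : ℂ) : ℂ := ∫ ξ : ℝ, Complex.exp (2 * Real.pi * Complex.I * z * ξ) * h ξ

lemma damp_damp (s t : ℝ) (h : ℝ → ℂ) : damp s (damp t h) = damp (s + t) h := by
  ext ξ
  simp only [damp]
  rw [← mul_assoc, ← Complex.ofReal_mul, ← Real.exp_add]
  ring_nf

lemma damp_zero (h : ℝ → ℂ) : damp 0 h = h := by ext; simp [damp]

lemma norm_damp (s : ℝ) (h : ℝ → ℂ) (ξ : ℝ) :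
    ‖damp s h ξ‖ = Real.exp (-2 * Real.pi * s * ξ) * ‖h ξ‖ := by
  rw [damp, norm_mul, Complex.norm_real, Real.norm_of_nonneg (Real.exp_pos _).le]

lemma continuous_dampFactor (s : ℝ) :
    Continuous fun ξ : ℝ => (Real.exp (-2 * Real.pi * s * ξ) : ℂ) := by fun_prop

lemma aestronglyMeasurable_damp {h : ℝ → ℂ} (hh : AEStronglyMeasurable h volume) (s : ℝ) :
    AEStronglyMeasurable (damp s h) volume :=
  (continuous_dampFactor s).aestronglyMeasurable.mul hh

lemma memLp_indicator_exp {c : ℝ} (hc : 0 < c) :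
    MemLp ((Set.Ioi (0 : ℝ)).indicator fun ξ : ℝ => (Real.exp (-c * ξ) : ℂ)) 2 volume := by
  have hcont : Continuous fun ξ : ℝ => (Real.exp (-c * ξ) : ℂ) := by fun_prop
  rw [memLp_indicator_iff_restrict measurableSet_Ioi,
    memLp_two_iff_integrable_sq_norm hcont.aestronglyMeasurable]
  refine (exp_neg_integrableOn_Ioi 0 (mul_pos two_pos hc)).congr_fun (fun ξ _ => ?_)
    measurableSet_Ioi
  simp only [Complex.norm_real, Real.norm_eq_abs, Real.abs_exp]
  rw [← Real.exp_nat_mul]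
  congr 1
  push_cast
  ring

namespace IsLaplaceL2

variable {h : ℝ → ℂ}

lemma aestronglyMeasurable (hh : IsLaplaceL2 h) : AEStronglyMeasurable h volume := by
  have h1 := aestronglyMeasurable_damp (hh.memLp 1 one_pos).1 (-1)
  rwa [damp_damp, neg_add_cancel, damp_zero] at h1

/-- Half of the damping stays with `h` and the other half is square integrable on the half-line.
This writes `damp s h` as a product of two `L²` functions, hence as an integrable function. -/
lemma damp_eq (hh : IsLaplaceL2 h) (s : ℝ) : damp s h
    = (Set.Ioi (0 : ℝ)).indicator (fun ξ : ℝ => (Real.exp (-(Real.pi * s) * ξ) : ℂ))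
      * damp (s / 2) h := by
  ext ξ
  rcases le_or_gt ξ 0 with hξ | hξ
  · simp [damp, hh.eq_zero ξ hξ]
  · rw [Pi.mul_apply, Set.indicator_of_mem (Set.mem_Ioi.2 hξ), damp, damp, ← mul_assoc,
      ← Complex.ofReal_mul, ← Real.exp_add]
    ring_nf

lemma integrable_damp (hh : IsLaplaceL2 h) {s : ℝ} (hs : 0 < s) : Integrable (damp s h) := by
  rw [hh.damp_eq]
  exact (memLp_indicator_exp (mul_pos Real.pi_pos hs)).integrable_mul (hh.memLp _ (half_pos hs))

lemma norm_kernel (h : ℝ → ℂ) (z : ℂ) (ξ : ℝ) :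
    ‖Complex.exp (2 * Real.pi * Complex.I * z * ξ) * h ξ‖ = ‖damp z.im h ξ‖ := by
  rw [norm_mul, norm_damp, Complex.norm_exp]
  congr 2
  simp

lemma aestronglyMeasurable_kernel (hh : IsLaplaceL2 h) (z : ℂ) :
    AEStronglyMeasurable (fun ξ : ℝ => Complex.exp (2 * Real.pi * Complex.I * z * ξ) * h ξ)
      volume :=
  (by fun_prop : Continuous fun ξ : ℝ =>
    Complex.exp (2 * Real.pi * Complex.I * z * ξ)).aestronglyMeasurable.mul hh.aestronglyMeasurable

lemma integrable_kernel (hh : IsLaplaceL2 h) {z : ℂ} (hz : 0 < z.im) :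
    Integrable fun ξ : ℝ => Complex.exp (2 * Real.pi * Complex.I * z * ξ) * h ξ :=
  (hh.integrable_damp hz).norm.mono' (hh.aestronglyMeasurable_kernel z)
    (Eventually.of_forall fun ξ => (norm_kernel h z ξ).le)

lemma differentiableOn_lap (hh : IsLaplaceL2 h) : DifferentiableOn ℂ (lap h) {z | 0 < z.im} := by
  intro z hz
  have hz : 0 < z.im := hz
  refine DifferentiableAt.differentiableWithinAt ?_
  have hU : {w : ℂ | z.im / 2 < w.im} ∈ 𝓝 z :=
    (isOpen_lt continuous_const Complex.continuous_im).mem_nhds (half_lt_self hz)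
  -- For `Im w > Im z / 2` the kernel is at most `e^{-π (Im z) ξ}`. Since `u ≤ e^u` with `u = π (Im
  -- z) ξ / 2`, the factor `2πξ` costs `4 / Im z` and half of this decay, leaving `damp (z.im / 4)`.
  refine (hasDerivAt_integral_of_dominated_loc_of_deriv_le
    (F := fun (w : ℂ) (ξ : ℝ) => Complex.exp (2 * Real.pi * Complex.I * w * ξ) * h ξ)
    (F' := fun (w : ℂ) (ξ : ℝ) => (2 * Real.pi * ξ * Complex.I) *
      (Complex.exp (2 * Real.pi * Complex.I * w * ξ) * h ξ))
    (bound := fun ξ => 4 / z.im * ‖damp (z.im / 4) h ξ‖) hU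
    (Eventually.of_forall hh.aestronglyMeasurable_kernel) (hh.integrable_kernel hz)
    ?_ ?_ ?_ ?_).2.differentiableAt
  · exact (by fun_prop : Continuous fun ξ : ℝ =>
      (2 * Real.pi * ξ * Complex.I : ℂ)).aestronglyMeasurable.mul (hh.aestronglyMeasurable_kernel z)
  · refine Eventually.of_forall fun ξ w hw => ?_
    rcases le_or_gt ξ 0 with hξ | hξ
    · simp [damp, hh.eq_zero ξ hξ]
    have hw : z.im / 2 < w.im := hw
    rw [norm_mul, norm_kernel, norm_damp, norm_damp, ← mul_assoc, ← mul_assoc]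
    refine mul_le_mul_of_nonneg_right ?_ (norm_nonneg _)
    have h1 : ‖(2 * Real.pi * ξ * Complex.I : ℂ)‖ = 2 * Real.pi * ξ := by
      simp [abs_of_pos hξ, abs_of_pos Real.pi_pos]
    have h2 : 2 * Real.pi * ξ ≤ 4 / z.im * Real.exp (Real.pi * z.im * ξ / 2) := by
      have := (le_of_lt (lt_add_one _)).trans (Real.add_one_le_exp (Real.pi * z.im * ξ / 2))
      calc 2 * Real.pi * ξ = 4 / z.im * (Real.pi * z.im * ξ / 2) := by field_simp; norm_num
        _ ≤ _ := by gcongr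
    have h3 : Real.exp (-2 * Real.pi * w.im * ξ) ≤ Real.exp (-(Real.pi * z.im * ξ)) := by
      refine Real.exp_le_exp.2 ?_
      have := mul_le_mul_of_nonneg_right hw.le (mul_pos Real.pi_pos hξ).le
      linarith
    rw [h1]
    calc _ ≤ (4 / z.im * Real.exp (Real.pi * z.im * ξ / 2)) * Real.exp (-(Real.pi * z.im * ξ)) := by
          gcongr
      _ = _ := by
          rw [mul_assoc, ← Real.exp_add]
          ring_nf
  · exact (hh.integrable_damp (by positivity)).norm.const_mul _
  · refine Eventually.of_forall fun ξ w _ => ?_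
    have h1 : HasDerivAt (fun w : ℂ => 2 * Real.pi * Complex.I * w * ξ)
        (2 * Real.pi * ξ * Complex.I) w := by
      exact (((hasDerivAt_id w).const_mul (2 * Real.pi * Complex.I : ℂ)).mul_const
        (ξ : ℂ)).congr_deriv (by ring)
    exact (h1.cexp.mul_const (h ξ)).congr_deriv (by ring)

lemma mdifferentiable_lap (hh : IsLaplaceL2 h) :
    MDifferentiable 𝓘(ℂ) 𝓘(ℂ) (fun z : ℍ => lap h z) := by
  rw [UpperHalfPlane.mdifferentiable_iff]
  refine hh.differentiableOn_lap.congr fun z hz => ?_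
  simp [UpperHalfPlane.ofComplex_apply_of_im_pos hz]

/-- The kernel factors as `e^{2πi(x+is)ξ} = e^{2πixξ} e^{-2πsξ}`. This is what makes Plancherel
available on each horizontal line. -/
lemma slice_lap (h : ℝ → ℂ) (s : Set.Ioi (0 : ℝ)) :
    slice (fun z : ℍ => lap h z) s = 𝓕⁻ (damp s h) := by
  ext x
  rw [Real.fourierInv_eq']
  change lap h ((x : ℂ) + (s : ℝ) * Complex.I) = _
  refine integral_congr_ae (Eventually.of_forall fun ξ => ?_)
  simp only [damp, smul_eq_mul, RCLike.inner_apply, conj_trivial]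
  rw [← mul_assoc, Complex.ofReal_exp, ← Complex.exp_add]
  congr 2
  push_cast
  linear_combination (2 * Real.pi * s * ξ : ℂ) * Complex.I_sq

lemma memLp_slice_lap (hh : IsLaplaceL2 h) (s : Set.Ioi (0 : ℝ)) :
    MemLp (slice (fun z : ℍ => lap h z) s) 2 volume := by
  rw [slice_lap]
  exact (memLp_congr_ae (coeFn_fourierInv_toLp (hh.integrable_damp s.2) (hh.memLp s s.2))).1
    (Lp.memLp _)

lemma toLp_slice_lap (hh : IsLaplaceL2 h) (s : Set.Ioi (0 : ℝ)) :
    (hh.memLp_slice_lap s).toLp _ = 𝓕⁻ ((hh.memLp s s.2).toLp _) := by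
  refine Lp.ext ((MemLp.coeFn_toLp _).trans ?_)
  rw [slice_lap]
  exact (coeFn_fourierInv_toLp (hh.integrable_damp s.2) (hh.memLp s s.2)).symm

lemma eLpNorm_slice_lap (hh : IsLaplaceL2 h) (s : Set.Ioi (0 : ℝ)) :
    eLpNorm (slice (fun z : ℍ => lap h z) s) 2 volume = eLpNorm (damp s h) 2 volume := by
  have h1 : ‖(hh.memLp_slice_lap s).toLp _‖ = ‖(hh.memLp s s.2).toLp _‖ := by
    rw [hh.toLp_slice_lap]
    exact (Lp.fourierTransformₗᵢ ℝ ℂ).symm.norm_map _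
  rw [Lp.norm_toLp, Lp.norm_toLp] at h1
  exact (ENNReal.toReal_eq_toReal_iff' (hh.memLp_slice_lap s).2.ne (hh.memLp s s.2).2.ne).1 h1

end IsLaplaceL2

/-! ### Dominated convergence in `L²` -/

lemma eLpNorm_two_sq {X : Type*} [MeasurableSpace X] (μ : Measure X) (f : X → ℂ) :
    eLpNorm f 2 μ ^ 2 = ∫⁻ x, ‖f x‖ₑ ^ 2 ∂μ := by
  have h := eLpNorm_nnreal_pow_eq_lintegral (f := f) (μ := μ) (p := 2) two_ne_zero
  simpa using h

/-- The limit itself dominates, so `|u i - g|² ≤ 4 |g|²`. This fits multiplication by factors of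
modulus at most `1` tending to `1`, namely `regularizer` and the exponential damping on the
half-line. -/
lemma tendsto_eLpNorm_two_sub_of_dominated {ι : Type*} {l : Filter ι} [l.IsCountablyGenerated]
    {u : ι → ℝ → ℂ} {g : ℝ → ℂ} (hu : ∀ i, AEStronglyMeasurable (u i) volume)
    (hg : MemLp g 2 volume) (hb : ∀ i x, ‖u i x‖ ≤ ‖g x‖)
    (hlim : ∀ x, Tendsto (fun i => u i x) l (𝓝 (g x))) :
    Tendsto (fun i => eLpNorm (u i - g) 2 volume) l (𝓝 0) := by
  have h2 : Tendsto (fun i => eLpNorm (u i - g) 2 volume ^ 2) l (𝓝 0) := by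
    simp only [eLpNorm_two_sq]
    have := tendsto_lintegral_filter_of_dominated_convergence' (μ := volume) (l := l)
      (F := fun i x => ‖(u i - g) x‖ₑ ^ 2) (f := fun _ => 0) (fun x => 4 * ‖g x‖ₑ ^ 2)
      (Eventually.of_forall fun i => ((hu i).sub hg.1).enorm.pow_const 2) ?_ ?_ ?_
    · simpa using this
    · refine Eventually.of_forall fun i => ?_
      refine Eventually.of_forall fun x => ?_
      have h1 : ‖(u i - g) x‖ₑ ≤ 2 * ‖g x‖ₑ := by
        refine (enorm_sub_le (a := u i x) (b := g x)).trans ?_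
        rw [two_mul]
        exact add_le_add_left (enorm_le_iff_norm_le.2 (hb i x)) _
      calc _ ≤ (2 * ‖g x‖ₑ) ^ 2 := by gcongr
        _ = _ := by rw [mul_pow]; norm_num
    · rw [lintegral_const_mul' _ _ (by norm_num), ← eLpNorm_two_sq]
      exact ENNReal.mul_ne_top (by norm_num) (ENNReal.pow_ne_top hg.2.ne)
    · refine Eventually.of_forall fun x => ?_
      have h0 : Tendsto (fun i => (u i - g) x) l (𝓝 0) := by
        simpa using (hlim x).sub_const (g x)
      have h1 := h0.enorm
      have h2 := ((ENNReal.continuous_pow 2).tendsto _).comp h1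
      simpa [Function.comp_def] using h2
  have h3 := (ENNReal.continuous_rpow_const (y := (1 / 2 : ℝ))).tendsto 0 |>.comp h2
  simp only [one_div, inv_pos, Nat.ofNat_pos, ENNReal.zero_rpow_of_pos, Function.comp_def] at h3
  refine h3.congr fun i => ?_
  rw [← ENNReal.rpow_natCast, ← ENNReal.rpow_mul]
  norm_num

lemma tendsto_toLp_of_dominated {ι : Type*} {l : Filter ι} [l.IsCountablyGenerated]
    {u : ι → ℝ → ℂ} {g : ℝ → ℂ} (hu : ∀ i, MemLp (u i) 2 volume)
    (hg : MemLp g 2 volume) (hb : ∀ i x, ‖u i x‖ ≤ ‖g x‖)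
    (hlim : ∀ x, Tendsto (fun i => u i x) l (𝓝 (g x))) :
    Tendsto (fun i => (hu i).toLp (u i)) l (𝓝 (hg.toLp g)) :=
  (Lp.tendsto_Lp_iff_tendsto_eLpNorm'' _ hu _ hg).2
    (tendsto_eLpNorm_two_sub_of_dominated (fun i => (hu i).1) hg hb hlim)

/-! ### Regularisation from `L²` to `L¹` -/

/-- The regularising factor `(1 - iεz)⁻¹`, bounded by `1` on the upper half-plane. -/
def regularizer (ε : ℝ) (z : ℂ) : ℂ := (1 - Complex.I * ε * z)⁻¹

lemma sq_norm_one_sub (ε x y : ℝ) :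
    ‖(1 - Complex.I * ε * (x + y * Complex.I) : ℂ)‖ ^ 2 = (1 + ε * y) ^ 2 + (ε * x) ^ 2 := by
  rw [← Complex.normSq_eq_norm_sq, Complex.normSq_apply]
  simp
  ring

/-- Source of both properties of the regularizer: it has modulus at most `1`, and for `ε > 0` it is
square integrable in `x` uniformly in `y`, so its product with an `L²` function is integrable. -/
lemma one_add_sq_le {ε y : ℝ} (hε : 0 ≤ ε) (hy : 0 ≤ y) (x : ℝ) :
    1 + (ε * x) ^ 2 ≤ ‖(1 - Complex.I * ε * (x + y * Complex.I) : ℂ)‖ ^ 2 := by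
  rw [sq_norm_one_sub]
  nlinarith [mul_nonneg hε hy]

lemma norm_regularizer_sq_le {ε y : ℝ} (hε : 0 ≤ ε) (hy : 0 ≤ y) (x : ℝ) :
    ‖regularizer ε (x + y * Complex.I)‖ ^ 2 ≤ (1 + (ε * x) ^ 2)⁻¹ := by
  rw [regularizer, norm_inv, inv_pow]
  exact inv_anti₀ (by positivity) (one_add_sq_le hε hy x)

lemma norm_regularizer_le_one {ε y : ℝ} (hε : 0 ≤ ε) (hy : 0 ≤ y) (x : ℝ) :
    ‖regularizer ε (x + y * Complex.I)‖ ≤ 1 := by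
  have h1 := norm_regularizer_sq_le hε hy x
  have h2 : (1 + (ε * x) ^ 2)⁻¹ ≤ 1 := inv_le_one_of_one_le₀ (by nlinarith [sq_nonneg (ε * x)])
  exact (sq_le_one_iff₀ (norm_nonneg _)).1 (h1.trans h2)

lemma one_sub_ne_zero {ε : ℝ} (hε : 0 ≤ ε) {z : ℂ} (hz : 0 ≤ z.im) :
    (1 - Complex.I * ε * z : ℂ) ≠ 0 := by
  intro h
  have h1 := one_add_sq_le hε hz z.re
  rw [Complex.re_add_im, h] at h1
  nlinarith [sq_nonneg (ε * z.re), norm_zero (E := ℂ)]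

lemma differentiableOn_regularizer {ε : ℝ} (hε : 0 ≤ ε) :
    DifferentiableOn ℂ (regularizer ε) {z | 0 < z.im} := by
  intro z hz
  refine DifferentiableAt.differentiableWithinAt ?_
  exact ((differentiableAt_const _).sub (differentiableAt_id.const_mul _)).inv
    (one_sub_ne_zero hε (le_of_lt hz))

lemma integrable_regularizer_bound {ε : ℝ} (hε : 0 < ε) :
    Integrable fun x : ℝ => (1 + (ε * x) ^ 2)⁻¹ :=
  integrable_inv_one_add_sq.comp_mul_left' hε.ne'

lemma measurable_regularizer (ε : ℝ) : Measurable (regularizer ε) := by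
  unfold regularizer
  fun_prop

lemma memLp_regularizer_line {ε y : ℝ} (hε : 0 < ε) (hy : 0 ≤ y) :
    MemLp (fun x : ℝ => regularizer ε (x + y * Complex.I)) 2 volume := by
  have hm : AEStronglyMeasurable (fun x : ℝ => regularizer ε (x + y * Complex.I)) volume :=
    ((measurable_regularizer ε).comp (by fun_prop)).aestronglyMeasurable
  rw [memLp_two_iff_integrable_sq_norm hm]
  refine (integrable_regularizer_bound hε).mono' (hm.norm.pow 2) (Eventually.of_forall fun x => ?_)
  rw [Real.norm_of_nonneg (by positivity)]
  exact norm_regularizer_sq_le hε.le hy x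

lemma memLp_regularizer_strip {ε a b : ℝ} (hε : 0 < ε) (ha : 0 ≤ a) :
    MemLp (fun p : ℝ × ℝ => regularizer ε (p.1 + p.2 * Complex.I)) 2
      (volume.prod (volume.restrict (Set.Ioc a b))) := by
  have hm : AEStronglyMeasurable (fun p : ℝ × ℝ => regularizer ε (p.1 + p.2 * Complex.I))
      (volume.prod (volume.restrict (Set.Ioc a b))) :=
    ((measurable_regularizer ε).comp (by fun_prop)).aestronglyMeasurable
  rw [memLp_two_iff_integrable_sq_norm hm]
  refine ((integrable_regularizer_bound hε).comp_fst _).mono' (hm.norm.pow 2) ?_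
  have h : ∀ᵐ p : ℝ × ℝ ∂(volume.prod (volume.restrict (Set.Ioc a b))), p.2 ∈ Set.Ioc a b :=
    Measure.quasiMeasurePreserving_snd.ae (ae_restrict_mem measurableSet_Ioc)
  filter_upwards [h] with p hp
  rw [Real.norm_of_nonneg (by positivity)]
  exact norm_regularizer_sq_le hε.le (ha.trans hp.1.le) p.1

lemma tendsto_regularizer {l : Filter ℕ} {ε : ℕ → ℝ} (hε : Tendsto ε l (𝓝 0)) (z : ℂ) :
    Tendsto (fun n => regularizer (ε n) z) l (𝓝 1) := by
  have h : Tendsto (fun n => (1 - Complex.I * ε n * z : ℂ)) l (𝓝 (1 - Complex.I * (0 : ℝ) * z)) :=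
    (((Complex.continuous_ofReal.tendsto 0).comp hε).const_mul _ |>.mul_const z).const_sub 1
  simpa [regularizer] using h.inv₀ (by simp)

/-! ### Comparison of Fourier transforms on two horizontal lines -/

section shift

variable {G : ℂ → ℂ} {a b : ℝ}

lemma damp_fourier_regularized (ha : 0 < a) (hab : a ≤ b) (hG : DifferentiableOn ℂ G {z | 0 < z.im})
    (hs : MemLp (fun p : ℝ × ℝ => G (p.1 + p.2 * Complex.I)) 2
      (volume.prod (volume.restrict (Set.Ioc a b))))
    (h1 : MemLp (fun x : ℝ => G (x + a * Complex.I)) 2 volume)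
    (h2 : MemLp (fun x : ℝ => G (x + b * Complex.I)) 2 volume) {ε : ℝ} (hε : 0 < ε) (ξ : ℝ) :
    damp (-a) (𝓕 fun x : ℝ => regularizer ε (x + a * Complex.I) * G (x + a * Complex.I)) ξ
    = damp (-b) (𝓕 fun x : ℝ => regularizer ε (x + b * Complex.I) * G (x + b * Complex.I)) ξ := by
  have hb : 0 < b := ha.trans_le hab
  -- At height `y` the exponential is `e^{-2πixξ} e^{2πyξ}`, so integrating `H` along that line
  -- gives `damp (-y)` of a Fourier transform. The contour shift for `H` is the claim.
  set H : ℂ → ℂ := fun z => Complex.exp (-2 * Real.pi * Complex.I * ξ * z)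
    * (regularizer ε z * G z) with hH
  have hE : ∀ x y : ℝ, Complex.exp (-2 * Real.pi * Complex.I * ξ * (x + y * Complex.I))
      = Real.exp (-2 * Real.pi * (-y) * ξ) *
        Complex.exp (((-2 * Real.pi * inner ℝ x ξ : ℝ) : ℂ) * Complex.I) := by
    intro x y
    rw [Complex.ofReal_exp, ← Complex.exp_add]
    congr 1
    simp only [RCLike.inner_apply, conj_trivial]
    push_cast
    linear_combination (-2 * Real.pi * ξ * y : ℂ) * Complex.I_sq
  have hEn : ∀ x y : ℝ, ‖Complex.exp (-2 * Real.pi * Complex.I * ξ * (x + y * Complex.I))‖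
      = Real.exp (-2 * Real.pi * (-y) * ξ) := by
    intro x y
    rw [hE, norm_mul, Complex.norm_exp_ofReal_mul_I, mul_one, Complex.norm_real,
      Real.norm_of_nonneg (Real.exp_pos _).le]
  have hI : ∀ y : ℝ, ∫ x : ℝ, H (x + y * Complex.I) = damp (-y)
      (𝓕 fun x : ℝ => regularizer ε (x + y * Complex.I) * G (x + y * Complex.I)) ξ := by
    intro y
    rw [damp, Real.fourier_eq', ← integral_const_mul]
    refine integral_congr_ae (Eventually.of_forall fun x => ?_)
    simp only [hH, hE, smul_eq_mul]
    ring
  have hline : ∀ y : ℝ, 0 < y → MemLp (fun x : ℝ => G (x + y * Complex.I)) 2 volume →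
      Integrable fun x : ℝ => H (x + y * Complex.I) := by
    intro y hy hm
    have := ((memLp_regularizer_line hε hy.le).integrable_mul hm)
    refine Integrable.bdd_mul (c := Real.exp (-2 * Real.pi * (-y) * ξ)) this ?_ ?_
    · exact (by fun_prop : Continuous fun x : ℝ =>
        Complex.exp (-2 * Real.pi * Complex.I * ξ * (x + y * Complex.I))).aestronglyMeasurable
    · exact Eventually.of_forall fun x => (hEn x y).le
  rw [← hI, ← hI]
  refine integral_horizontal_eq ha hab ?_ ?_ (hline a ha h1) (hline b hb h2)
  · exact (by fun_prop : Differentiable ℂ fun z : ℂ =>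
      Complex.exp (-2 * Real.pi * Complex.I * ξ * z)).differentiableOn.mul
      ((differentiableOn_regularizer hε.le).mul hG)
  · refine Integrable.bdd_mul (c := Real.exp (2 * Real.pi * b * |ξ|))
      ((memLp_regularizer_strip hε ha.le).integrable_mul hs) ?_ ?_
    · exact (by fun_prop : Continuous fun p : ℝ × ℝ =>
        Complex.exp (-2 * Real.pi * Complex.I * ξ * (p.1 + p.2 * Complex.I))).aestronglyMeasurable
    · have h : ∀ᵐ p : ℝ × ℝ ∂(volume.prod (volume.restrict (Set.Ioc a b))), p.2 ∈ Set.Ioc a b :=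
        Measure.quasiMeasurePreserving_snd.ae (ae_restrict_mem measurableSet_Ioc)
      filter_upwards [h] with p hp
      rw [hEn]
      refine Real.exp_le_exp.2 ?_
      have h1 : p.2 * ξ ≤ b * |ξ| := (mul_le_mul_of_nonneg_left (le_abs_self ξ)
        (ha.trans hp.1).le).trans (mul_le_mul_of_nonneg_right hp.2 (abs_nonneg ξ))
      nlinarith [Real.pi_pos]

/-- The Fourier transforms of the `L²` restrictions of a holomorphic function to two horizontal
lines differ by an exponential factor. -/
lemma damp_fourier_line (ha : 0 < a) (hab : a ≤ b) (hG : DifferentiableOn ℂ G {z | 0 < z.im})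
    (hs : MemLp (fun p : ℝ × ℝ => G (p.1 + p.2 * Complex.I)) 2
      (volume.prod (volume.restrict (Set.Ioc a b))))
    (h1 : MemLp (fun x : ℝ => G (x + a * Complex.I)) 2 volume)
    (h2 : MemLp (fun x : ℝ => G (x + b * Complex.I)) 2 volume) :
    damp (-a) (𝓕 (h1.toLp _) : Lp ℂ 2 (volume : Measure ℝ)) =ᵐ[volume]
      damp (-b) (𝓕 (h2.toLp _) : Lp ℂ 2 (volume : Measure ℝ)) := by
  set ε : ℕ → ℝ := fun n => 1 / ((n : ℝ) + 1) with hε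
  have hε0 : ∀ n, 0 < ε n := fun n => by positivity
  have hεl : Tendsto ε atTop (𝓝 0) := tendsto_one_div_add_atTop_nhds_zero_nat
  let u : ℝ → ℕ → ℝ → ℂ := fun y n x =>
    regularizer (ε n) (x + y * Complex.I) * G (x + y * Complex.I)
  have main : ∀ y : ℝ, 0 < y → ∀ h : MemLp (fun x : ℝ => G (x + y * Complex.I)) 2 volume,
      ∃ _ : ∀ n, Integrable (u y n), ∃ hu : ∀ n, MemLp (u y n) 2 volume,
        Tendsto (fun n => (hu n).toLp (u y n)) atTop (𝓝 (h.toLp _)) := by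
    intro y hy h
    have hub : ∀ n x, ‖u y n x‖ ≤ ‖G (x + y * Complex.I)‖ := fun n x => by
      rw [norm_mul]
      exact mul_le_of_le_one_left (norm_nonneg _) (norm_regularizer_le_one (hε0 n).le hy.le x)
    have hi : ∀ n, Integrable (u y n) := fun n =>
      (memLp_regularizer_line (hε0 n) hy.le).integrable_mul h
    have hu : ∀ n, MemLp (u y n) 2 volume := fun n =>
      h.of_le (hi n).1 (Eventually.of_forall (hub n))
    refine ⟨hi, hu, tendsto_toLp_of_dominated hu h hub fun x => ?_⟩
    simpa using (tendsto_regularizer hεl (x + y * Complex.I)).mul_const (G (x + y * Complex.I))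
  obtain ⟨hi1, hu1, hl1⟩ := main a ha h1
  obtain ⟨hi2, hu2, hl2⟩ := main b (ha.trans_le hab) h2
  have hF := (Lp.fourierTransformₗᵢ ℝ ℂ).continuous
  have hm1 := tendstoInMeasure_of_tendsto_Lp ((hF.tendsto _).comp hl1)
  have hm2 := tendstoInMeasure_of_tendsto_Lp ((hF.tendsto _).comp hl2)
  -- `L²` convergence gives almost everywhere convergence only along a subsequence. The second one
  -- is extracted from the first, so both lines converge along `ns ∘ ms`.
  obtain ⟨ns, hns, hae1⟩ := hm1.exists_seq_tendsto_ae
  obtain ⟨ms, hms, hae2⟩ := (hm2.comp hns.tendsto_atTop).exists_seq_tendsto_ae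
  have hc1 := ae_all_iff.2 fun n => coeFn_fourier_toLp (hi1 n) (hu1 n)
  have hc2 := ae_all_iff.2 fun n => coeFn_fourier_toLp (hi2 n) (hu2 n)
  filter_upwards [hae1, hae2, hc1, hc2] with ξ k1 k2 k3 k4
  have k1' := (k1.comp hms.tendsto_atTop).const_mul (Real.exp (-2 * Real.pi * (-a) * ξ) : ℂ)
  have k2' := k2.const_mul (Real.exp (-2 * Real.pi * (-b) * ξ) : ℂ)
  refine tendsto_nhds_unique k1' (k2'.congr fun n => ?_)
  have key := damp_fourier_regularized ha hab hG hs h1 h2 (hε0 (ns (ms n))) ξ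
  have e1 := k3 (ns (ms n))
  have e2 := k4 (ns (ms n))
  simp only [damp] at key
  change _ * (𝓕 ((hu2 (ns (ms n))).toLp _) : Lp ℂ 2 (volume : Measure ℝ)) ξ
    = _ * (𝓕 ((hu1 (ns (ms n))).toLp _) : Lp ℂ 2 (volume : Measure ℝ)) ξ
  rw [e1, e2]
  exact key.symm

end shift

/-! ### Vanishing on the negative half-line -/

lemma lintegral_exp_div_sq_eq_top {c : ℝ} (hc : 0 < c) :
    ∫⁻ y in Set.Ioi (1 : ℝ), ENNReal.ofReal (y ^ 2)⁻¹ * ENNReal.ofReal (Real.exp (c * y)) = ∞ := by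
  have h1 : ∫⁻ _ in Set.Ioi (1 : ℝ), ENNReal.ofReal (c ^ 2 / 2) = ∞ := by
    rw [setLIntegral_const, Real.volume_Ioi]
    exact ENNReal.mul_top (ENNReal.ofReal_pos.2 (by positivity)).ne'
  refine eq_top_mono (setLIntegral_mono' measurableSet_Ioi fun y hy => ?_) h1
  have hy : (0 : ℝ) < y := zero_lt_one.trans hy
  rw [← ENNReal.ofReal_mul (by positivity)]
  refine ENNReal.ofReal_le_ofReal ?_
  have h2 := Real.quadratic_le_exp_of_nonneg (mul_pos hc hy).le
  have h3 : (c * y) ^ 2 / 2 ≤ Real.exp (c * y) := by nlinarith [mul_pos hc hy]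
  calc c ^ 2 / 2 = (y ^ 2)⁻¹ * ((c * y) ^ 2 / 2) := by field_simp
    _ ≤ _ := by gcongr

lemma enorm_damp_sq (s : ℝ) (h : ℝ → ℂ) (ξ : ℝ) :
    ‖damp s h ξ‖ₑ ^ 2 = ENNReal.ofReal (Real.exp (-4 * Real.pi * s * ξ)) * ‖h ξ‖ₑ ^ 2 := by
  rw [← ofReal_norm, ← ofReal_norm, norm_damp,
    ENNReal.ofReal_mul (Real.exp_pos _).le, mul_pow, ← ENNReal.ofReal_pow (Real.exp_pos _).le,
    ← Real.exp_nat_mul]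
  congr 3
  push_cast
  ring

/-- If the dampings of `h` do not grow exponentially, then `h` vanishes on the negative
half-line. -/
lemma ae_eq_zero_of_lintegral_damp {h : ℝ → ℂ} (hm : StronglyMeasurable h)
    (hfin : ∫⁻ y in Set.Ioi (1 : ℝ), ENNReal.ofReal (y ^ 2)⁻¹ * ∫⁻ ξ, ‖damp y h ξ‖ₑ ^ 2 < ∞) :
    ∀ᵐ ξ, ξ < 0 → h ξ = 0 := by
  have hmeas : Measurable (Function.uncurry fun (y ξ : ℝ) =>
      ENNReal.ofReal (y ^ 2)⁻¹ * ENNReal.ofReal (Real.exp (-4 * Real.pi * y * ξ))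
        * ‖h ξ‖ₑ ^ 2) := by
    have h1 : Measurable fun p : ℝ × ℝ => h p.2 := hm.measurable.comp measurable_snd
    have h2 : Measurable fun p : ℝ × ℝ => ‖h p.2‖ₑ ^ 2 := h1.enorm.pow_const 2
    exact (by fun_prop : Measurable fun p : ℝ × ℝ =>
      ENNReal.ofReal (p.1 ^ 2)⁻¹ * ENNReal.ofReal (Real.exp (-4 * Real.pi * p.1 * p.2))).mul h2
  -- By Tonelli, `‖h ξ‖²` is weighted by an integral over `y` that is infinite when `ξ < 0`;
  -- finiteness then forces `h ξ = 0` for almost every such `ξ`.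
  have e : ∫⁻ y in Set.Ioi (1 : ℝ), ENNReal.ofReal (y ^ 2)⁻¹ * ∫⁻ ξ, ‖damp y h ξ‖ₑ ^ 2
      = ∫⁻ ξ, (∫⁻ y in Set.Ioi (1 : ℝ), ENNReal.ofReal (y ^ 2)⁻¹
        * ENNReal.ofReal (Real.exp (-4 * Real.pi * y * ξ))) * ‖h ξ‖ₑ ^ 2 := by
    calc _ = ∫⁻ y in Set.Ioi (1 : ℝ), ∫⁻ ξ, ENNReal.ofReal (y ^ 2)⁻¹
          * ENNReal.ofReal (Real.exp (-4 * Real.pi * y * ξ)) * ‖h ξ‖ₑ ^ 2 := by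
          refine lintegral_congr fun y => ?_
          rw [← lintegral_const_mul' _ _ ENNReal.ofReal_ne_top]
          simp only [enorm_damp_sq, mul_assoc]
      _ = ∫⁻ ξ, ∫⁻ y in Set.Ioi (1 : ℝ), ENNReal.ofReal (y ^ 2)⁻¹
          * ENNReal.ofReal (Real.exp (-4 * Real.pi * y * ξ)) * ‖h ξ‖ₑ ^ 2 :=
          lintegral_lintegral_swap hmeas.aemeasurable
      _ = _ := by
          refine lintegral_congr fun ξ => ?_
          rw [lintegral_mul_const' _ _ (ENNReal.pow_ne_top enorm_ne_top)]
  rw [e] at hfin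
  have hmeas' : Measurable fun ξ => (∫⁻ y in Set.Ioi (1 : ℝ), ENNReal.ofReal (y ^ 2)⁻¹
        * ENNReal.ofReal (Real.exp (-4 * Real.pi * y * ξ))) * ‖h ξ‖ₑ ^ 2 := by
    refine Measurable.mul ?_ (hm.measurable.enorm.pow_const 2)
    exact Measurable.lintegral_prod_left' (f := fun p : ℝ × ℝ => ENNReal.ofReal (p.1 ^ 2)⁻¹
        * ENNReal.ofReal (Real.exp (-4 * Real.pi * p.1 * p.2))) (by fun_prop)
  filter_upwards [ae_lt_top hmeas' hfin.ne] with ξ hξ hneg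
  by_contra hne
  refine hξ.ne ?_
  have h1 : (0 : ℝ) < -4 * Real.pi * ξ := by nlinarith [Real.pi_pos]
  have h2 := lintegral_exp_div_sq_eq_top h1
  have h3 : ∀ y, -4 * Real.pi * y * ξ = -4 * Real.pi * ξ * y := fun y => by ring
  simp only [h3]
  rw [h2]
  exact ENNReal.top_mul (by simpa using hne)

/-! ### A Paley-Wiener theorem -/

section PaleyWiener

variable {G : ℂ → ℂ}

lemma point_mem {y : ℝ} (hy : 0 < y) (x : ℝ) : (x + y * Complex.I : ℂ) ∈ {z : ℂ | 0 < z.im} := by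
  simpa using hy

lemma continuous_line (hG : ContinuousOn G {z | 0 < z.im}) {y : ℝ} (hy : 0 < y) :
    Continuous fun x : ℝ => G (x + y * Complex.I) :=
  hG.comp_continuous (by fun_prop) (point_mem hy)

lemma aestronglyMeasurable_strip (hG : ContinuousOn G {z | 0 < z.im}) {S : Set ℝ}
    (hS : MeasurableSet S) (hS0 : S ⊆ Set.Ioi 0) :
    AEStronglyMeasurable (fun p : ℝ × ℝ => G (p.1 + p.2 * Complex.I))
      (volume.prod (volume.restrict S)) := by
  have h : (volume : Measure ℝ).prod (volume.restrict S)
      = ((volume : Measure ℝ).prod volume).restrict (Set.univ ×ˢ S) := by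
    rw [← Measure.prod_restrict, Measure.restrict_univ]
  rw [h]
  refine ContinuousOn.aestronglyMeasurable ?_ (MeasurableSet.univ.prod hS)
  exact hG.comp (by fun_prop) fun p hp => point_mem (hS0 hp.2) p.1

lemma aemeasurable_lintegral_line (hG : ContinuousOn G {z | 0 < z.im}) {S : Set ℝ}
    (hS : MeasurableSet S) (hS0 : S ⊆ Set.Ioi 0) :
    AEMeasurable (fun y : ℝ => ∫⁻ x : ℝ, ‖G (x + y * Complex.I)‖ₑ ^ 2) (volume.restrict S) :=
  ((aestronglyMeasurable_strip hG hS hS0).enorm.pow_const 2).lintegral_prod_left'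

lemma memLp_two_of_lintegral_lt_top {X : Type*} [MeasurableSpace X] {μ : Measure X} {f : X → ℂ}
    (hf : AEStronglyMeasurable f μ) (h : ∫⁻ x, ‖f x‖ₑ ^ 2 ∂μ < ∞) : MemLp f 2 μ := by
  refine ⟨hf, ?_⟩
  rw [← eLpNorm_two_sq] at h
  simpa using h

lemma ae_memLp_line (hG : ContinuousOn G {z | 0 < z.im})
    (hW : ∀ a > 0, ∫⁻ y in Set.Ioi a, ENNReal.ofReal (y ^ 2)⁻¹
      * ∫⁻ x : ℝ, ‖G (x + y * Complex.I)‖ₑ ^ 2 < ∞) :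
    ∀ᵐ y : ℝ, 0 < y → MemLp (fun x : ℝ => G (x + y * Complex.I)) 2 volume := by
  have h1 : ∀ n : ℕ, ∀ᵐ y : ℝ, y ∈ Set.Ioi (1 / ((n : ℝ) + 1)) →
      ENNReal.ofReal (y ^ 2)⁻¹ * ∫⁻ x : ℝ, ‖G (x + y * Complex.I)‖ₑ ^ 2 < ∞ := by
    intro n
    have hn : (0 : ℝ) < 1 / ((n : ℝ) + 1) := by positivity
    rw [← ae_restrict_iff' measurableSet_Ioi]
    refine ae_lt_top' (AEMeasurable.mul (by fun_prop) (aemeasurable_lintegral_line hG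
      measurableSet_Ioi (Set.Ioi_subset_Ioi hn.le))) (hW _ hn).ne
  filter_upwards [ae_all_iff.2 h1] with y hy hy0
  obtain ⟨n, hn⟩ := exists_nat_one_div_lt hy0
  refine memLp_two_of_lintegral_lt_top (continuous_line hG hy0).aestronglyMeasurable ?_
  refine ENNReal.lt_top_of_mul_ne_top_right (hy n hn).ne (ENNReal.ofReal_pos.2 ?_).ne'
  positivity

/-- On `(a, b]` the weight `y⁻²` is at least `b⁻²`, so it can be removed at the cost of a factor
`b²`. -/
lemma memLp_strip (hG : ContinuousOn G {z | 0 < z.im})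
    (hW : ∀ a > 0, ∫⁻ y in Set.Ioi a, ENNReal.ofReal (y ^ 2)⁻¹
      * ∫⁻ x : ℝ, ‖G (x + y * Complex.I)‖ₑ ^ 2 < ∞) {a b : ℝ} (ha : 0 < a) :
    MemLp (fun p : ℝ × ℝ => G (p.1 + p.2 * Complex.I)) 2
      (volume.prod (volume.restrict (Set.Ioc a b))) := by
  have hm := aestronglyMeasurable_strip hG (measurableSet_Ioc (a := a) (b := b))
    (fun y hy => ha.trans hy.1)
  refine memLp_two_of_lintegral_lt_top hm ?_
  rw [lintegral_prod_symm _ (hm.enorm.pow_const 2)]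
  calc ∫⁻ y in Set.Ioc a b, ∫⁻ x : ℝ, ‖G (x + y * Complex.I)‖ₑ ^ 2
      ≤ ∫⁻ y in Set.Ioc a b, ENNReal.ofReal (b ^ 2) * (ENNReal.ofReal (y ^ 2)⁻¹
        * ∫⁻ x : ℝ, ‖G (x + y * Complex.I)‖ₑ ^ 2) := by
        refine setLIntegral_mono' measurableSet_Ioc fun y hy => ?_
        have hy0 : 0 < y := ha.trans hy.1
        rw [← mul_assoc, ← ENNReal.ofReal_mul (by positivity)]
        refine le_mul_of_one_le_left' ?_
        rw [ENNReal.one_le_ofReal, ← div_eq_mul_inv, one_le_div (by positivity)]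
        have := hy.2
        gcongr
    _ = ENNReal.ofReal (b ^ 2) * ∫⁻ y in Set.Ioc a b, (ENNReal.ofReal (y ^ 2)⁻¹
        * ∫⁻ x : ℝ, ‖G (x + y * Complex.I)‖ₑ ^ 2) := lintegral_const_mul' _ _ ENNReal.ofReal_ne_top
    _ < ∞ := ENNReal.mul_lt_top ENNReal.ofReal_lt_top
        ((lintegral_mono_set Set.Ioc_subset_Ioi_self).trans_lt (hW a ha))

lemma enorm_toLp_fourier_sq {f : ℝ → ℂ} (hf : MemLp f 2 volume) :
    ∫⁻ ξ, ‖(𝓕 (hf.toLp f) : Lp ℂ 2 (volume : Measure ℝ)) ξ‖ₑ ^ 2 = ∫⁻ x, ‖f x‖ₑ ^ 2 := by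
  have h1 : ‖(𝓕 (hf.toLp f) : Lp ℂ 2 (volume : Measure ℝ))‖ = ‖hf.toLp f‖ := Lp.norm_fourier_eq _
  rw [Lp.norm_toLp, Lp.norm_def,
    ENNReal.toReal_eq_toReal_iff' (Lp.memLp _).2.ne hf.2.ne] at h1
  rw [← eLpNorm_two_sq, ← eLpNorm_two_sq, h1]

/-- A Paley-Wiener theorem: holomorphic functions on the upper half-plane with a mild integrability
property are Fourier-Laplace transforms. -/
theorem exists_isLaplaceL2 (hG : DifferentiableOn ℂ G {z | 0 < z.im})
    (hW : ∀ a > 0, ∫⁻ y in Set.Ioi a, ENNReal.ofReal (y ^ 2)⁻¹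
      * ∫⁻ x : ℝ, ‖G (x + y * Complex.I)‖ₑ ^ 2 < ∞) :
    ∃ h, IsLaplaceL2 h ∧ ∀ z : ℂ, 0 < z.im → G z = lap h z := by
  have hae := ae_memLp_line hG.continuousOn hW
  -- Only almost every line is known to be in `L²`, which still provides arbitrarily low ones.
  have hex : ∀ c : ℝ, 0 < c → ∃ y : ℝ, 0 < y ∧ y < c ∧
      MemLp (fun x : ℝ => G (x + y * Complex.I)) 2 volume := by
    intro c hc
    by_contra! hcon
    have h0 : volume (Set.Ioo 0 c) = 0 :=
      measure_mono_null (fun y hy => by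
        simpa using ⟨hy.1, hcon y hy.1 hy.2⟩) (ae_iff.1 hae)
    simp [hc.not_ge] at h0
  obtain ⟨b, hb, -, hGb⟩ := hex 1 one_pos
  -- The damping acquired at height `b` is undone; `hline` then recovers every other good line from
  -- `h₀`.
  set h₀ : ℝ → ℂ := damp (-b) (𝓕 (hGb.toLp _) : Lp ℂ 2 (volume : Measure ℝ)) with hh₀
  have hh₀m : StronglyMeasurable h₀ :=
    (continuous_dampFactor (-b)).stronglyMeasurable.mul (Lp.stronglyMeasurable _)
  have hline : ∀ y : ℝ, 0 < y → ∀ hy : MemLp (fun x : ℝ => G (x + y * Complex.I)) 2 volume,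
      (𝓕 (hy.toLp _) : Lp ℂ 2 (volume : Measure ℝ)) =ᵐ[volume] damp y h₀ := by
    intro y hy0 hy
    have h1 : damp (-y) (𝓕 (hy.toLp _) : Lp ℂ 2 (volume : Measure ℝ)) =ᵐ[volume] h₀ := by
      rcases le_total y b with hyb | hyb
      · exact damp_fourier_line hy0 hyb hG (memLp_strip hG.continuousOn hW hy0) hy hGb
      · exact (damp_fourier_line hb hyb hG (memLp_strip hG.continuousOn hW hb) hGb hy).symm
    filter_upwards [h1] with ξ hξ
    rw [damp, ← hξ]
    change _ = damp y (damp (-y) _) ξ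
    rw [damp_damp, add_neg_cancel, damp_zero]
  have hneg : ∀ᵐ ξ, ξ < 0 → h₀ ξ = 0 := by
    refine ae_eq_zero_of_lintegral_damp hh₀m (lt_of_eq_of_lt ?_ (hW 1 one_pos))
    refine setLIntegral_congr_fun_ae measurableSet_Ioi ?_
    filter_upwards [hae] with y hy hy1
    have hy0 : 0 < y := zero_lt_one.trans hy1
    rw [← enorm_toLp_fourier_sq (hy hy0)]
    congr 1
    refine lintegral_congr_ae ?_
    filter_upwards [hline y hy0 (hy hy0)] with ξ hξ
    rw [hξ]
  -- `IsLaplaceL2` asks for vanishing at every `ξ ≤ 0`, not just almost every one, so the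
  -- representative is changed.
  set h : ℝ → ℂ := (Set.Ioi (0 : ℝ)).indicator h₀ with hh
  have hhae : h =ᵐ[volume] h₀ := by
    filter_upwards [hneg, volume.ae_ne (0 : ℝ)] with ξ h1 h2
    rcases lt_or_gt_of_ne h2 with h3 | h3
    · rw [h1 h3, hh, Set.indicator_of_notMem (by simpa using h3.le)]
    · rw [hh, Set.indicator_of_mem (Set.mem_Ioi.2 h3)]
  have hdamp : ∀ y, damp y h =ᵐ[volume] damp y h₀ := fun y => by
    filter_upwards [hhae] with ξ hξ
    rw [damp, damp, hξ]
  have hzero : ∀ ξ ≤ 0, h ξ = 0 := fun ξ hξ => Set.indicator_of_notMem (by simpa using hξ) _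
  have hL : IsLaplaceL2 h := by
    refine ⟨hzero, fun s hs => ?_⟩
    -- On the half-line damping by `s` is stronger than damping by a good height `y < s`.
    obtain ⟨y, hy0, hys, hy⟩ := hex s hs
    have h1 : MemLp (damp y h) 2 volume :=
      (memLp_congr_ae ((hline y hy0 hy).trans (hdamp y).symm)).1 (Lp.memLp _)
    refine h1.of_le (aestronglyMeasurable_damp (hh₀m.indicator measurableSet_Ioi).aestronglyMeasurable
      s) (Eventually.of_forall fun ξ => ?_)
    rcases le_or_gt ξ 0 with hξ | hξ
    · simp [damp, hzero ξ hξ]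
    rw [norm_damp, norm_damp]
    refine mul_le_mul_of_nonneg_right (Real.exp_le_exp.2 ?_) (norm_nonneg _)
    have := mul_le_mul_of_nonneg_right hys.le (mul_pos Real.pi_pos hξ).le
    linarith
  refine ⟨h, hL, ?_⟩
  have heq : ∀ y : ℝ, 0 < y → MemLp (fun x : ℝ => G (x + y * Complex.I)) 2 volume →
      ∀ x : ℝ, G (x + y * Complex.I) = lap h (x + y * Complex.I) := by
    intro y hy0 hy
    have h1 : hy.toLp _ = (hL.memLp_slice_lap ⟨y, hy0⟩).toLp _ := by
      rw [hL.toLp_slice_lap]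
      have h2 : (hL.memLp y hy0).toLp _ = 𝓕 (hy.toLp _) :=
        Lp.ext ((MemLp.coeFn_toLp _).trans ((hdamp y).trans (hline y hy0 hy).symm))
      rw [h2, FourierTransform.fourierInv_fourier_eq]
    exact congrFun ((Continuous.ae_eq_iff_eq volume (continuous_line hG.continuousOn hy0)
      (continuous_line hL.differentiableOn_lap.continuousOn hy0)).1 ((MemLp.toLp_eq_toLp_iff _ _).1 h1))
  intro z hz
  have hc : ∀ {g : ℂ → ℂ}, ContinuousOn g {z | 0 < z.im} →
      ContinuousOn (fun y : ℝ => g (z.re + y * Complex.I)) (Set.Ioi 0) := fun hg =>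
    hg.comp (by fun_prop) fun y hy => point_mem hy _
  -- On the vertical line through `z` both functions are continuous and agree at almost every
  -- height, hence at every height.
  have hall := Measure.eqOn_open_of_ae_eq (μ := volume) (U := Set.Ioi (0 : ℝ)) ?_ isOpen_Ioi
    (hc hG.continuousOn) (hc hL.differentiableOn_lap.continuousOn)
  · have := hall hz
    simpa [Complex.re_add_im] using this
  · rw [EventuallyEq, ae_restrict_iff' measurableSet_Ioi]
    filter_upwards [hae] with y hy hy0 using heq y hy0 (hy hy0) z.re

end PaleyWiener

/-! ### Hardy functions and their boundary values -/

section Hardy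

variable {h : ℝ → ℂ}

lemma norm_damp_le (h0 : ∀ ξ ≤ 0, h ξ = 0) {s : ℝ} (hs : 0 ≤ s) (ξ : ℝ) :
    ‖damp s h ξ‖ ≤ ‖h ξ‖ := by
  rcases le_or_gt ξ 0 with hξ | hξ
  · simp [damp, h0 ξ hξ]
  rw [norm_damp]
  refine mul_le_of_le_one_left (norm_nonneg _) (Real.exp_le_one_iff.2 ?_)
  have := mul_nonneg (mul_nonneg Real.pi_pos.le hs) hξ.le
  linarith

lemma isLaplaceL2_of_memLp (h0 : ∀ ξ ≤ 0, h ξ = 0) (hh : MemLp h 2 volume) : IsLaplaceL2 h :=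
  ⟨h0, fun s hs => hh.of_le (aestronglyMeasurable_damp hh.1 s)
    (Eventually.of_forall (norm_damp_le h0 (le_of_lt hs)))⟩

lemma tendsto_damp {ι : Type*} {l : Filter ι} {s : ι → ℝ} (hs : Tendsto s l (𝓝 0)) (ξ : ℝ) :
    Tendsto (fun i => damp (s i) h ξ) l (𝓝 (h ξ)) := by
  have h1 : Continuous fun s : ℝ => damp s h ξ := by
    unfold damp
    fun_prop
  have h2 := (h1.tendsto 0).comp hs
  rwa [damp_zero] at h2

/-- Damping only decreases the norm, and Fatou along the heights `1 / (n + 1)` gives the reverse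
inequality. Both sides may be infinite, so this also decides membership in the Hardy space. -/
lemma IsLaplaceL2.hardyENorm_lap (hh : IsLaplaceL2 h) :
    hardyENorm (fun z : ℍ => lap h z) = eLpNorm h 2 volume := by
  simp only [hardyENorm, hh.eLpNorm_slice_lap]
  refine le_antisymm (iSup_le fun s => eLpNorm_mono (norm_damp_le hh.eq_zero (le_of_lt s.2))) ?_
  have h1 := Lp.eLpNorm_lim_le_liminf_eLpNorm (μ := volume) (p := 2)
    (f := fun n : ℕ => damp (1 / ((n : ℝ) + 1)) h)
    (fun n => aestronglyMeasurable_damp hh.aestronglyMeasurable _) h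
    (Eventually.of_forall fun ξ => tendsto_damp tendsto_one_div_add_atTop_nhds_zero_nat ξ)
  refine h1.trans (liminf_le_of_le (by isBoundedDefault) fun b hb => ?_)
  obtain ⟨n, hn⟩ := hb.exists
  exact hn.trans (le_iSup (fun s : Set.Ioi (0 : ℝ) => eLpNorm (damp s h) 2 volume)
    ⟨1 / ((n : ℝ) + 1), by simp only [Set.mem_Ioi]; positivity⟩)

lemma lintegral_inv_sq_lt_top {a : ℝ} (ha : 0 < a) :
    ∫⁻ y in Set.Ioi a, ENNReal.ofReal (y ^ 2)⁻¹ < ∞ := by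
  have h1 : IntegrableOn (fun y : ℝ => (y ^ 2)⁻¹) (Set.Ioi a) := by
    refine (integrableOn_Ioi_rpow_of_lt (a := -2) (by norm_num) ha).congr_fun (fun y hy => ?_)
      measurableSet_Ioi
    have hy : 0 < y := ha.trans hy
    simp only
    rw [Real.rpow_neg hy.le]
    norm_num
  exact h1.lintegral_lt_top

lemma ofComplex_line (f : ℍ → ℂ) {y : ℝ} (hy : 0 < y) (x : ℝ) :
    (f ∘ UpperHalfPlane.ofComplex) (x + y * Complex.I) = slice f ⟨y, hy⟩ x := by
  rw [Function.comp_apply, UpperHalfPlane.ofComplex_apply_of_im_pos (point_mem hy x)]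
  rfl

/-- Hardy functions are Fourier-Laplace transforms of `L²` functions on the half-line. -/
theorem HardySpace.exists_lap (f : HardySpace) :
    ∃ h, IsLaplaceL2 h ∧ MemLp h 2 volume ∧ (f : ℍ → ℂ) = fun z : ℍ => lap h z := by
  have hW : ∀ a > 0, ∫⁻ y in Set.Ioi a, ENNReal.ofReal (y ^ 2)⁻¹
      * ∫⁻ x : ℝ, ‖((f : ℍ → ℂ) ∘ UpperHalfPlane.ofComplex) (x + y * Complex.I)‖ₑ ^ 2 < ∞ := by
    intro a ha
    -- The line integrals are bounded uniformly in `y`, and `y⁻²` is integrable at infinity.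
    calc ∫⁻ y in Set.Ioi a, ENNReal.ofReal (y ^ 2)⁻¹
          * ∫⁻ x : ℝ, ‖((f : ℍ → ℂ) ∘ UpperHalfPlane.ofComplex) (x + y * Complex.I)‖ₑ ^ 2
        ≤ ∫⁻ y in Set.Ioi a, ENNReal.ofReal (y ^ 2)⁻¹ * hardyENorm f ^ 2 := by
          refine setLIntegral_mono' measurableSet_Ioi fun y hy => mul_le_mul_right ?_ _
          have hy : 0 < y := ha.trans hy
          simp only [ofComplex_line _ hy]
          rw [← eLpNorm_two_sq]
          exact pow_le_pow_left' (le_iSup (fun s => eLpNorm (slice f s) 2 volume) ⟨y, hy⟩) 2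
      _ = (∫⁻ y in Set.Ioi a, ENNReal.ofReal (y ^ 2)⁻¹) * hardyENorm f ^ 2 :=
          lintegral_mul_const' _ _ (ENNReal.pow_ne_top f.2.2.ne)
      _ < ∞ := ENNReal.mul_lt_top (lintegral_inv_sq_lt_top ha) (ENNReal.pow_lt_top f.2.2)
  obtain ⟨h, hh, hf⟩ := exists_isLaplaceL2 (UpperHalfPlane.mdifferentiable_iff.1 f.2.1) hW
  have hf' : (f : ℍ → ℂ) = fun z : ℍ => lap h z := by
    ext z
    simpa using hf z z.im_pos
  refine ⟨h, hh, ⟨hh.aestronglyMeasurable, ?_⟩, hf'⟩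
  rw [← hh.hardyENorm_lap, ← hf']
  exact f.2.2

instance : heightToZero.IsCountablyGenerated := by
  unfold heightToZero
  infer_instance

/-- Limits along this filter are therefore unique, which lets `limUnder` in `boundary` be evaluated.
-/
instance : heightToZero.NeBot := by
  rw [heightToZero, comap_neBot_iff]
  intro t ht
  obtain ⟨ε, hε, hb⟩ := Metric.mem_nhds_iff.1 ht
  refine ⟨⟨ε / 2, half_pos hε⟩, hb ?_⟩
  simp [abs_of_pos hε, hε]

variable {f : HardySpace}

lemma tendsto_sliceL2 (hh : IsLaplaceL2 h) (h2 : MemLp h 2 volume)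
    (hf : (f : ℍ → ℂ) = fun z : ℍ => lap h z) :
    Tendsto (sliceL2 f) heightToZero (𝓝 (𝓕⁻ (h2.toLp h))) := by
  have h1 : ∀ s, sliceL2 f s = 𝓕⁻ ((hh.memLp s s.2).toLp _) := fun s => by
    rw [← hh.toLp_slice_lap, sliceL2]
    congr 1
    rw [hf]
  refine Tendsto.congr (fun s => (h1 s).symm) ?_
  refine ((Lp.fourierTransformₗᵢ ℝ ℂ).symm.continuous.tendsto _).comp ?_
  exact tendsto_toLp_of_dominated (fun s : Set.Ioi (0 : ℝ) => hh.memLp s s.2) h2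
    (fun s => norm_damp_le hh.eq_zero (le_of_lt s.2)) fun ξ => tendsto_damp tendsto_comap ξ

lemma boundary_eq (hh : IsLaplaceL2 h) (h2 : MemLp h 2 volume)
    (hf : (f : ℍ → ℂ) = fun z : ℍ => lap h z) : boundary f = 𝓕⁻ (h2.toLp h) :=
  (tendsto_sliceL2 hh h2 hf).limUnder_eq

lemma tendsto_boundary (f : HardySpace) :
    Tendsto (sliceL2 f) heightToZero (𝓝 (boundary f)) := by
  obtain ⟨h, hh, h2, hf⟩ := HardySpace.exists_lap f
  rw [boundary_eq hh h2 hf]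
  exact tendsto_sliceL2 hh h2 hf

lemma two_pi_pos : (0 : ℝ) < 2 * Real.pi := by positivity

lemma unitaryFourier_boundary (hh : IsLaplaceL2 h) (h2 : MemLp h 2 volume)
    (hf : (f : ℍ → ℂ) = fun z : ℍ => lap h z) :
    ∀ᵐ t, unitaryFourier (boundary f) t
      = ((Real.sqrt (2 * Real.pi))⁻¹ : ℝ) * h (t / (2 * Real.pi)) := by
  have h1 : (𝓕 (boundary f) : Lp ℂ 2 (volume : Measure ℝ)) =ᵐ[volume] h := by
    rw [boundary_eq hh h2 hf, FourierTransform.fourier_fourierInv_eq]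
    exact h2.coeFn_toLp
  -- An almost everywhere identity survives the substitution because dilations preserve null sets.
  have hq : Measure.QuasiMeasurePreserving (fun t : ℝ => t / (2 * Real.pi)) volume volume := by
    refine ⟨by fun_prop, ?_⟩
    simp only [div_eq_mul_inv]
    rw [Real.map_volume_mul_right (inv_ne_zero two_pi_pos.ne')]
    exact Measure.smul_absolutelyContinuous
  filter_upwards [hq.ae h1] with t ht
  rw [unitaryFourier, ht]

/-! ### The Bergman transform on the Fourier side -/

/-- The multiplier by which the Bergman transform acts on the Fourier side. -/
def berSymbol (α : ℝ) (h : ℝ → ℂ) (ξ : ℝ) : ℂ :=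
  ((Real.sqrt (2 * Real.pi) * (2 * Real.pi * ξ) ^ α : ℝ) : ℂ) * h ξ

/-- Raise `u ≤ e^u`, with `u = c x / α`, to the power `α`. The bound lets half of a damping absorb
the power in `berSymbol`. -/
lemma rpow_mul_exp_neg_le {α c x : ℝ} (hα : 0 < α) (hc : 0 < c) (hx : 0 ≤ x) :
    x ^ α * Real.exp (-(c * x)) ≤ (α / c) ^ α := by
  have h1 : c * x / α ≤ Real.exp (c * x / α) := by
    linarith [Real.add_one_le_exp (c * x / α)]
  have h2 : (c * x / α) ^ α ≤ Real.exp (c * x) := by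
    refine (Real.rpow_le_rpow (by positivity) h1 hα.le).trans_eq ?_
    rw [← Real.exp_mul, div_mul_cancel₀ _ hα.ne']
  have h3 : x ^ α = (α / c) ^ α * (c * x / α) ^ α := by
    rw [← Real.mul_rpow (by positivity) (by positivity)]
    congr 1
    field_simp
  calc x ^ α * Real.exp (-(c * x))
      ≤ ((α / c) ^ α * Real.exp (c * x)) * Real.exp (-(c * x)) := by
        rw [h3]
        gcongr
    _ = _ := by rw [mul_assoc, ← Real.exp_add, add_neg_cancel, Real.exp_zero, mul_one]

lemma isLaplaceL2_berSymbol {α : ℝ} (hα : 0 < α) (hh : IsLaplaceL2 h) :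
    IsLaplaceL2 (berSymbol α h) := by
  have hm : AEStronglyMeasurable (berSymbol α h) volume := by
    refine AEStronglyMeasurable.mul ?_ hh.aestronglyMeasurable
    exact (by fun_prop : Measurable fun ξ : ℝ =>
      ((Real.sqrt (2 * Real.pi) * (2 * Real.pi * ξ) ^ α : ℝ) : ℂ)).aestronglyMeasurable
  refine ⟨fun ξ hξ => by simp [berSymbol, hh.eq_zero ξ hξ], fun s hs => ?_⟩
  refine (hh.memLp (s / 2) (half_pos hs)).of_le_mul
    (c := Real.sqrt (2 * Real.pi) * (α / (s / 2)) ^ α) (aestronglyMeasurable_damp hm s)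
    (Eventually.of_forall fun ξ => ?_)
  rcases le_or_gt ξ 0 with hξ | hξ
  · simp [damp, berSymbol, hh.eq_zero ξ hξ]
  have hx : 0 < 2 * Real.pi * ξ := mul_pos two_pi_pos hξ
  rw [norm_damp, norm_damp, berSymbol, norm_mul, Complex.norm_real,
    Real.norm_of_nonneg (by positivity), ← mul_assoc (Real.exp _), ← mul_assoc (_ * _) (Real.exp _)]
  refine mul_le_mul_of_nonneg_right ?_ (norm_nonneg _)
  have h1 := rpow_mul_exp_neg_le hα (half_pos hs) hx.le
  calc Real.exp (-2 * Real.pi * s * ξ) * (Real.sqrt (2 * Real.pi) * (2 * Real.pi * ξ) ^ α)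
      = Real.sqrt (2 * Real.pi) * ((2 * Real.pi * ξ) ^ α * Real.exp (-(s / 2 * (2 * Real.pi * ξ))))
        * Real.exp (-2 * Real.pi * (s / 2) * ξ) := by
        have : -2 * Real.pi * s * ξ
          = -(s / 2 * (2 * Real.pi * ξ)) + -2 * Real.pi * (s / 2) * ξ := by ring
        rw [this, Real.exp_add]
        ring
    _ ≤ _ := by gcongr

/-- With `t = 2πξ`, the factor `(2π)^{-1/2}` of the unitary transform and `dt = 2π dξ` combine to
the `√(2π)` in `berSymbol`. -/
lemma berIntegrand_ae_eq (α : ℝ) (hh : IsLaplaceL2 h) (h2 : MemLp h 2 volume)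
    (hf : (f : ℍ → ℂ) = fun z : ℍ => lap h z) (z : ℍ) :
    berIntegrand α f z =ᵐ[volume.restrict (Set.Ioi 0)] fun t : ℝ =>
      (2 * Real.pi : ℂ)⁻¹ * (Complex.exp (2 * Real.pi * Complex.I * z * (t / (2 * Real.pi) : ℝ))
        * berSymbol α h (t / (2 * Real.pi))) := by
  refine ae_restrict_of_ae ?_
  filter_upwards [unitaryFourier_boundary hh h2 hf] with t ht
  have hpi : (2 * Real.pi : ℂ) ≠ 0 := by exact_mod_cast two_pi_pos.ne'
  have e1 : (2 * Real.pi * Complex.I * z * (t / (2 * Real.pi) : ℝ) : ℂ) = Complex.I * z * t := by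
    push_cast
    field_simp
  have e2 : 2 * Real.pi * (t / (2 * Real.pi)) = t := by field_simp
  have e3 : (((Real.sqrt (2 * Real.pi))⁻¹ : ℝ) : ℂ)
      = (2 * Real.pi : ℂ)⁻¹ * (Real.sqrt (2 * Real.pi) : ℂ) := by
    have h3 : (Real.sqrt (2 * Real.pi))⁻¹ = (2 * Real.pi)⁻¹ * Real.sqrt (2 * Real.pi) := by
      have := Real.sqrt_pos.2 two_pi_pos
      field_simp
      rw [Real.sq_sqrt two_pi_pos.le]
    rw [h3]
    push_cast
    ring
  rw [berIntegrand, ht, e1, berSymbol, e2, e3]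
  push_cast
  ring

lemma integrableOn_berIntegrand_of_lap {α : ℝ} (hα : 0 < α) (hh : IsLaplaceL2 h)
    (h2 : MemLp h 2 volume) (hf : (f : ℍ → ℂ) = fun z : ℍ => lap h z) (z : ℍ) :
    IntegrableOn (berIntegrand α f z) (Set.Ioi (0 : ℝ)) := by
  refine Integrable.congr (Integrable.integrableOn ?_) (berIntegrand_ae_eq α hh h2 hf z).symm
  exact (((isLaplaceL2_berSymbol hα hh).integrable_kernel z.im_pos).comp_div
    two_pi_pos.ne').const_mul _

lemma integrableOn_berIntegrand {α : ℝ} (hα : 0 < α) (f : HardySpace) (z : ℍ) :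
    IntegrableOn (berIntegrand α f z) (Set.Ioi (0 : ℝ)) := by
  obtain ⟨h, hh, h2, hf⟩ := HardySpace.exists_lap f
  exact integrableOn_berIntegrand_of_lap hα hh h2 hf z

lemma ber_eq_lap (α : ℝ) (hh : IsLaplaceL2 h) (h2 : MemLp h 2 volume)
    (hf : (f : ℍ → ℂ) = fun z : ℍ => lap h z) (z : ℍ) :
    Ber α f z = lap (berSymbol α h) z := by
  set k : ℝ → ℂ := fun ξ => Complex.exp (2 * Real.pi * Complex.I * z * ξ) * berSymbol α h ξ with hk
  have hk0 : ∀ ξ ≤ 0, k ξ = 0 := fun ξ hξ => by simp [hk, berSymbol, hh.eq_zero ξ hξ]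
  have h1 : Ber α f z = (2 * Real.pi : ℂ)⁻¹ * ∫ t in Set.Ioi (0 : ℝ), k (t / (2 * Real.pi)) := by
    rw [Ber, integral_congr_ae (berIntegrand_ae_eq α hh h2 hf z), integral_const_mul]
  have h3 : ∫ t in Set.Ioi (0 : ℝ), k (t / (2 * Real.pi)) = ∫ t, k (t / (2 * Real.pi)) := by
    refine setIntegral_eq_integral_of_forall_compl_eq_zero fun t ht => hk0 _ ?_
    exact div_nonpos_of_nonpos_of_nonneg (not_lt.1 ht) two_pi_pos.le
  rw [h1, h3, Measure.integral_comp_div, abs_of_pos two_pi_pos, lap, Complex.real_smul, ← mul_assoc]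
  push_cast
  rw [inv_mul_cancel₀ (by exact_mod_cast two_pi_pos.ne'), one_mul]

end Hardy

/-! ### The Bergman norm as a weighted `L²` norm -/

lemma lintegral_comap_coe (φ : ℂ → ℝ≥0∞) :
    ∫⁻ z : ℍ, φ z ∂(Measure.comap UpperHalfPlane.coe volume)
      = ∫⁻ p : ℝ × ℝ, φ (p.1 + p.2 * Complex.I) ∂(volume.prod (volume.restrict (Set.Ioi 0))) := by
  have hr : Set.range UpperHalfPlane.coe = {z : ℂ | 0 < z.im} := by
    ext z
    exact ⟨by rintro ⟨w, rfl⟩; exact w.im_pos, fun hz => ⟨⟨z, hz⟩, rfl⟩⟩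
  have h : (volume : Measure ℝ).prod (volume.restrict (Set.Ioi (0 : ℝ)))
      = (volume : Measure (ℝ × ℝ)).restrict (Set.univ ×ˢ Set.Ioi 0) := by
    rw [Measure.volume_eq_prod, ← Measure.prod_restrict, Measure.restrict_univ]
  rw [← UpperHalfPlane.measurableEmbedding_coe.lintegral_map,
    UpperHalfPlane.measurableEmbedding_coe.map_comap, hr, h,
    ← Complex.volume_preserving_equiv_real_prod.setLIntegral_comp_preimage_emb
      Complex.measurableEquivRealProd.measurableEmbedding]
  have hs : Complex.measurableEquivRealProd ⁻¹' (Set.univ ×ˢ Set.Ioi 0) = {z : ℂ | 0 < z.im} := by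
    ext z
    simp
  rw [hs]
  simp

lemma lintegral_bergmanMeasure (β : ℝ) {F : ℍ → ℂ}
    (hF : ContinuousOn (F ∘ UpperHalfPlane.ofComplex) {z | 0 < z.im}) :
    ∫⁻ z, ‖F z‖ₑ ^ 2 ∂(bergmanMeasure β) = ∫⁻ y in Set.Ioi (0 : ℝ), ENNReal.ofReal (y ^ (β - 2))
      * ∫⁻ x : ℝ, ‖(F ∘ UpperHalfPlane.ofComplex) (x + y * Complex.I)‖ₑ ^ 2 := by
  set G := F ∘ UpperHalfPlane.ofComplex with hG
  have hFG : ∀ z : ℍ, F z = G z := fun z => by simp [hG]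
  have hFc : Continuous F := by
    have : F = G ∘ UpperHalfPlane.coe := funext hFG
    rw [this]
    exact hF.comp_continuous UpperHalfPlane.continuous_coe fun z => z.im_pos
  have him : Measurable fun z : ℍ => z.im := UpperHalfPlane.continuous_im.measurable
  rw [bergmanMeasure, lintegral_withDensity_eq_lintegral_mul _
    (him.pow_const _).ennreal_ofReal (hFc.measurable.enorm.pow_const 2)]
  have h1 := lintegral_comap_coe fun w => ENNReal.ofReal (w.im ^ (β - 2)) * ‖G w‖ₑ ^ 2
  have h2 : ∀ z : ℍ, ((fun z : ℍ => ENNReal.ofReal (z.im ^ (β - 2))) * fun z => ‖F z‖ₑ ^ 2) z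
      = ENNReal.ofReal ((z : ℂ).im ^ (β - 2)) * ‖G z‖ₑ ^ 2 := fun z => by
    rw [Pi.mul_apply, hFG, UpperHalfPlane.coe_im]
  rw [lintegral_congr h2, h1, lintegral_prod_symm]
  · refine lintegral_congr fun y => ?_
    rw [← lintegral_const_mul' _ _ ENNReal.ofReal_ne_top]
    simp
  · refine AEMeasurable.mul (f := fun p : ℝ × ℝ =>
      ENNReal.ofReal ((p.1 + p.2 * Complex.I : ℂ).im ^ (β - 2)))
      (Measurable.aemeasurable (by fun_prop)) ?_
    exact (aestronglyMeasurable_strip hF measurableSet_Ioi subset_rfl).enorm.pow_const 2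

lemma lintegral_rpow_mul_exp {a r : ℝ} (ha : 0 < a) (hr : 0 < r) :
    ∫⁻ y in Set.Ioi (0 : ℝ), ENNReal.ofReal (y ^ (a - 1)) * ENNReal.ofReal (Real.exp (-(r * y)))
      = ENNReal.ofReal ((1 / r) ^ a * Real.Gamma a) := by
  have h1 := Real.integral_rpow_mul_exp_neg_mul_Ioi ha hr
  -- A nonintegrable function has Bochner integral `0`, so a nonzero value proves integrability.
  have hpos : 0 < (1 / r) ^ a * Real.Gamma a :=
    mul_pos (Real.rpow_pos_of_pos (by positivity) _) (Real.Gamma_pos_of_pos ha)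
  rw [← h1, ofReal_integral_eq_lintegral_ofReal
    (Integrable.of_integral_ne_zero (by rw [h1]; exact hpos.ne'))]
  · refine setLIntegral_congr_fun measurableSet_Ioi fun y hy => ?_
    rw [ENNReal.ofReal_mul (Real.rpow_nonneg (le_of_lt hy) _)]
  · filter_upwards [ae_restrict_mem measurableSet_Ioi] with y hy
    exact mul_nonneg (Real.rpow_nonneg (le_of_lt hy) _) (Real.exp_pos _).le

section

variable {α : ℝ} {g h : ℝ → ℂ}

/-- The Bergman norm of a Fourier-Laplace transform is a weighted `L²` norm. -/
lemma lintegral_bergmanMeasure_lap (hα : 0 < α) (hg : IsLaplaceL2 g) :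
    ∫⁻ z : ℍ, ‖lap g z‖ₑ ^ 2 ∂(bergmanMeasure (2 * α + 1))
      = ∫⁻ ξ : ℝ, ENNReal.ofReal ((1 / (4 * Real.pi * ξ)) ^ (2 * α) * Real.Gamma (2 * α))
        * ‖g ξ‖ₑ ^ 2 := by
  have hmeas : AEMeasurable (Function.uncurry fun (y ξ : ℝ) =>
      ENNReal.ofReal (y ^ (2 * α - 1)) * ENNReal.ofReal (Real.exp (-4 * Real.pi * y * ξ))
        * ‖g ξ‖ₑ ^ 2) ((volume.restrict (Set.Ioi 0)).prod volume) := by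
    have h1 : AEMeasurable (fun p : ℝ × ℝ => ‖g p.2‖ₑ ^ 2)
        ((volume.restrict (Set.Ioi 0)).prod volume) :=
      hg.aestronglyMeasurable.comp_snd.enorm.pow_const 2
    exact (by fun_prop : Measurable fun p : ℝ × ℝ => ENNReal.ofReal (p.1 ^ (2 * α - 1))
      * ENNReal.ofReal (Real.exp (-4 * Real.pi * p.1 * p.2))).aemeasurable.mul h1
  rw [lintegral_bergmanMeasure (F := fun z : ℍ => lap g z) _
    (UpperHalfPlane.mdifferentiable_iff.1 hg.mdifferentiable_lap).continuousOn]
  -- Plancherel on each line, then Tonelli, then a Gamma integral in `y` with rate `4πξ`.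
  calc _ = ∫⁻ y in Set.Ioi (0 : ℝ), ∫⁻ ξ : ℝ, ENNReal.ofReal (y ^ (2 * α - 1))
        * ENNReal.ofReal (Real.exp (-4 * Real.pi * y * ξ)) * ‖g ξ‖ₑ ^ 2 := by
        refine setLIntegral_congr_fun measurableSet_Ioi fun y hy => ?_
        have he : 2 * α + 1 - 2 = 2 * α - 1 := by ring
        simp only [ofComplex_line _ hy, mul_assoc]
        rw [lintegral_const_mul' _ _ ENNReal.ofReal_ne_top, ← eLpNorm_two_sq,
          hg.eLpNorm_slice_lap, eLpNorm_two_sq, he]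
        simp only [enorm_damp_sq, mul_assoc]
    _ = ∫⁻ ξ : ℝ, ∫⁻ y in Set.Ioi (0 : ℝ), ENNReal.ofReal (y ^ (2 * α - 1))
        * ENNReal.ofReal (Real.exp (-4 * Real.pi * y * ξ)) * ‖g ξ‖ₑ ^ 2 :=
        lintegral_lintegral_swap hmeas
    _ = _ := by
        refine lintegral_congr fun ξ => ?_
        rw [lintegral_mul_const' _ _ (ENNReal.pow_ne_top enorm_ne_top)]
        rcases le_or_gt ξ 0 with hξ | hξ
        · simp [hg.eq_zero ξ hξ]
        rw [← lintegral_rpow_mul_exp (mul_pos two_pos hα) (by positivity : 0 < 4 * Real.pi * ξ)]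
        congr 1
        refine lintegral_congr fun y => ?_
        congr 3
        ring

/-- The square of the normalising constant. -/
def berConst (α : ℝ) : ℝ := 2 * Real.pi * Real.Gamma (2 * α) / 4 ^ α

lemma berConst_pos (hα : 0 < α) : 0 < berConst α :=
  div_pos (mul_pos two_pi_pos (Real.Gamma_pos_of_pos (by positivity)))
    (Real.rpow_pos_of_pos (by norm_num) _)

/-- The powers of `ξ` cancel: `2πξ / (4πξ) = 1/2`, whose power `2α` is the `4 ^ (-α)` in the
constant. -/
lemma berConst_eq {ξ : ℝ} (hξ : 0 < ξ) :
    (1 / (4 * Real.pi * ξ)) ^ (2 * α) * Real.Gamma (2 * α)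
      * (Real.sqrt (2 * Real.pi) * (2 * Real.pi * ξ) ^ α) ^ 2 = berConst α := by
  have hx : 0 < 2 * Real.pi * ξ := mul_pos two_pi_pos hξ
  have h1 : ((2 * Real.pi * ξ) ^ α) ^ 2 = (2 * Real.pi * ξ) ^ (2 * α) := by
    rw [← Real.rpow_natCast, ← Real.rpow_mul hx.le, mul_comm α]
    norm_num
  have h2 : (1 / (4 * Real.pi * ξ)) ^ (2 * α) * (2 * Real.pi * ξ) ^ (2 * α) = (4 ^ α)⁻¹ := by
    rw [← Real.mul_rpow (by positivity) hx.le]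
    have : 1 / (4 * Real.pi * ξ) * (2 * Real.pi * ξ) = 2⁻¹ := by
      field_simp
      norm_num
    rw [this, Real.inv_rpow two_pos.le, Real.rpow_mul two_pos.le]
    norm_num
  rw [mul_pow, Real.sq_sqrt two_pi_pos.le, h1, berConst, div_eq_mul_inv (_ * _), ← h2]
  ring

lemma lintegral_bergmanMeasure_berSymbol (hα : 0 < α) (h0 : ∀ ξ ≤ 0, h ξ = 0)
    (hg : IsLaplaceL2 (berSymbol α h)) :
    ∫⁻ z : ℍ, ‖lap (berSymbol α h) z‖ₑ ^ 2 ∂(bergmanMeasure (2 * α + 1))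
      = ENNReal.ofReal (berConst α) * ∫⁻ ξ, ‖h ξ‖ₑ ^ 2 := by
  rw [lintegral_bergmanMeasure_lap hα hg, ← lintegral_const_mul' _ _ ENNReal.ofReal_ne_top]
  refine lintegral_congr fun ξ => ?_
  rcases le_or_gt ξ 0 with hξ | hξ
  · simp [berSymbol, h0 ξ hξ]
  have hx : 0 < 2 * Real.pi * ξ := mul_pos two_pi_pos hξ
  have hG := Real.Gamma_pos_of_pos (mul_pos two_pos hα)
  rw [← berConst_eq hξ, ENNReal.ofReal_mul (mul_pos (Real.rpow_pos_of_pos (by positivity) _) hG).le,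
    mul_assoc (ENNReal.ofReal _), berSymbol, enorm_mul, mul_pow, ← ofReal_norm, Complex.norm_real,
    Real.norm_of_nonneg (by positivity), ENNReal.ofReal_pow (by positivity)]

/-- Since `h` is not assumed to be in `L²`, the identity works both ways: it puts `Ber α f` in the
Bergman space, and it proves `h ∈ L²` in the surjectivity argument. -/
lemma eLpNorm_bergman_berSymbol (hα : 0 < α) (h0 : ∀ ξ ≤ 0, h ξ = 0)
    (hg : IsLaplaceL2 (berSymbol α h)) :
    eLpNorm (fun z : ℍ => lap (berSymbol α h) z) 2 (bergmanMeasure (2 * α + 1))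
      = ENNReal.ofReal (Real.sqrt (berConst α)) * eLpNorm h 2 volume := by
  refine (ENNReal.pow_right_strictMono two_ne_zero).injective.eq_iff.1 ?_
  rw [mul_pow, eLpNorm_two_sq, eLpNorm_two_sq, lintegral_bergmanMeasure_berSymbol hα h0 hg,
    ← ENNReal.ofReal_pow (Real.sqrt_nonneg _), Real.sq_sqrt (berConst_pos hα).le]

/-- Functions in the Bergman space are Fourier-Laplace transforms. -/
theorem BergmanSpace.exists_lap (hα : 0 < α) (F : BergmanSpace (2 * α + 1)) :
    ∃ g, IsLaplaceL2 g ∧ (F : ℍ → ℂ) = fun z : ℍ => lap g z := by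
  have hd := UpperHalfPlane.mdifferentiable_iff.1 F.2.1
  have hfin : ∫⁻ z, ‖(F : ℍ → ℂ) z‖ₑ ^ 2 ∂(bergmanMeasure (2 * α + 1)) < ∞ := by
    rw [← eLpNorm_two_sq]
    exact ENNReal.pow_lt_top F.2.2.2
  rw [lintegral_bergmanMeasure _ hd.continuousOn] at hfin
  obtain ⟨g, hg, hF⟩ := exists_isLaplaceL2 hd fun a ha => by
    -- For `y > a` one has `y⁻² ≤ a^{-(2α+1)} y^{2α-1}`.
    refine lt_of_le_of_lt ?_ (ENNReal.mul_lt_top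
      (ENNReal.ofReal_lt_top (r := (a ^ (2 * α + 1))⁻¹)) hfin)
    rw [← lintegral_const_mul' _ _ ENNReal.ofReal_ne_top]
    refine (setLIntegral_mono' measurableSet_Ioi fun y hy => ?_).trans
      (lintegral_mono_set (Set.Ioi_subset_Ioi ha.le))
    have hy0 : 0 < y := ha.trans hy
    have hap := Real.rpow_pos_of_pos ha (2 * α + 1)
    rw [← mul_assoc, ← ENNReal.ofReal_mul (by positivity)]
    refine mul_le_mul_left (ENNReal.ofReal_le_ofReal ?_) _
    have h1 : y ^ (2 * α + 1 - 2) = y ^ (2 * α + 1) * (y ^ 2)⁻¹ := by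
      rw [Real.rpow_sub hy0, div_eq_mul_inv]
      norm_num
    have h2 : a ^ (2 * α + 1) ≤ y ^ (2 * α + 1) :=
      Real.rpow_le_rpow ha.le (le_of_lt hy) (by positivity)
    rw [h1, ← mul_assoc]
    refine le_mul_of_one_le_left (by positivity) ?_
    rw [inv_mul_eq_div]
    exact (one_le_div hap).2 h2
  refine ⟨g, hg, ?_⟩
  ext z
  simpa using hF z z.im_pos

/-! ### Linearity, isometry and surjectivity -/

lemma lap_add (hg : IsLaplaceL2 g) (hh : IsLaplaceL2 h) (z : ℍ) :
    lap (g + h) z = lap g z + lap h z := by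
  rw [lap, lap, lap, ← integral_add (hg.integrable_kernel z.im_pos) (hh.integrable_kernel z.im_pos)]
  simp only [Pi.add_apply, mul_add]

lemma lap_smul (c : ℂ) (h : ℝ → ℂ) (z : ℂ) : lap (c • h) z = c * lap h z := by
  rw [lap, lap, ← integral_const_mul]
  refine integral_congr_ae (Eventually.of_forall fun ξ => ?_)
  simp only [Pi.smul_apply, smul_eq_mul]
  ring

lemma IsLaplaceL2.add (hg : IsLaplaceL2 g) (hh : IsLaplaceL2 h) : IsLaplaceL2 (g + h) := by
  refine ⟨fun ξ hξ => by simp [hg.eq_zero ξ hξ, hh.eq_zero ξ hξ], fun s hs => ?_⟩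
  have : damp s (g + h) = damp s g + damp s h := by
    ext ξ
    simp [damp, mul_add]
  rw [this]
  exact (hg.memLp s hs).add (hh.memLp s hs)

lemma IsLaplaceL2.const_smul (c : ℂ) (hh : IsLaplaceL2 h) : IsLaplaceL2 (c • h) := by
  refine ⟨fun ξ hξ => by simp [hh.eq_zero ξ hξ], fun s hs => ?_⟩
  have : damp s (c • h) = c • damp s h := by
    ext ξ
    simp only [damp, Pi.smul_apply, smul_eq_mul]
    ring
  rw [this]
  exact (hh.memLp s hs).const_smul c

/-- `ber_eq_lap` accepts any `L²` representative, so `h₁ + h₂` may be used for the sum and no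
additivity of `boundary` is needed. -/
lemma ber_add (hα : 0 < α) (f₁ f₂ : HardySpace) : Ber α (f₁ + f₂) = Ber α f₁ + Ber α f₂ := by
  obtain ⟨h₁, hL₁, hm₁, hf₁⟩ := HardySpace.exists_lap f₁
  obtain ⟨h₂, hL₂, hm₂, hf₂⟩ := HardySpace.exists_lap f₂
  have hf : ((f₁ + f₂ : HardySpace) : ℍ → ℂ) = fun z : ℍ => lap (h₁ + h₂) z := by
    ext z
    rw [lap_add hL₁ hL₂, Submodule.coe_add, hf₁, hf₂]
    rfl
  ext z
  have hs : berSymbol α (h₁ + h₂) = berSymbol α h₁ + berSymbol α h₂ := by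
    ext ξ
    simp [berSymbol, mul_add]
  rw [Pi.add_apply, ber_eq_lap α (hL₁.add hL₂) (hm₁.add hm₂) hf, ber_eq_lap α hL₁ hm₁ hf₁,
    ber_eq_lap α hL₂ hm₂ hf₂, hs,
    lap_add (isLaplaceL2_berSymbol hα hL₁) (isLaplaceL2_berSymbol hα hL₂)]

lemma ber_smul (α : ℝ) (c : ℂ) (f : HardySpace) : Ber α (c • f) = c • Ber α f := by
  obtain ⟨h, hL, hm, hf⟩ := HardySpace.exists_lap f
  have hf' : ((c • f : HardySpace) : ℍ → ℂ) = fun z : ℍ => lap (c • h) z := by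
    ext z
    rw [lap_smul, Submodule.coe_smul, hf]
    rfl
  ext z
  have hs : berSymbol α (c • h) = c • berSymbol α h := by
    ext ξ
    simp only [berSymbol, Pi.smul_apply, smul_eq_mul]
    ring
  rw [Pi.smul_apply, ber_eq_lap α (hL.const_smul c) (hm.const_smul c) hf', ber_eq_lap α hL hm hf,
    hs, lap_smul, smul_eq_mul]

lemma ber_mem_bergmanSpace (hα : 0 < α) (f : HardySpace) : Ber α f ∈ BergmanSpace (2 * α + 1) := by
  obtain ⟨h, hL, hm, hf⟩ := HardySpace.exists_lap f
  have hg := isLaplaceL2_berSymbol hα hL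
  have hB : Ber α f = fun z : ℍ => lap (berSymbol α h) z := funext (ber_eq_lap α hL hm hf)
  rw [hB]
  refine ⟨hg.mdifferentiable_lap, hg.mdifferentiable_lap.continuous.aestronglyMeasurable, ?_⟩
  rw [eLpNorm_bergman_berSymbol hα hL.eq_zero hg]
  exact ENNReal.mul_lt_top ENNReal.ofReal_lt_top hm.2

/-- The Bergman transform as a linear map from the Hardy space to the Bergman space. -/
def berLinearMap (hα : 0 < α) : HardySpace →ₗ[ℂ] BergmanSpace (2 * α + 1) where
  toFun f := ⟨Ber α f, ber_mem_bergmanSpace hα f⟩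
  map_add' f₁ f₂ := Subtype.ext (ber_add hα f₁ f₂)
  map_smul' c f := Subtype.ext (ber_smul α c f)

lemma norm_berLinearMap (hα : 0 < α) (f : HardySpace) :
    ‖berLinearMap hα f‖ = Real.sqrt (berConst α) * ‖f‖ := by
  obtain ⟨h, hL, hm, hf⟩ := HardySpace.exists_lap f
  have hB : Ber α f = fun z : ℍ => lap (berSymbol α h) z := funext (ber_eq_lap α hL hm hf)
  have h1 : ‖berLinearMap hα f‖ = (eLpNorm (Ber α f) 2 (bergmanMeasure (2 * α + 1))).toReal :=
    Lp.norm_toLp _ (ber_mem_bergmanSpace hα f).2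
  have h2 : ‖f‖ = (hardyENorm (f : ℍ → ℂ)).toReal := rfl
  rw [h1, h2, hB, eLpNorm_bergman_berSymbol hα hL.eq_zero (isLaplaceL2_berSymbol hα hL), hf,
    hL.hardyENorm_lap, ENNReal.toReal_mul, ENNReal.toReal_ofReal (Real.sqrt_nonneg _)]

lemma berLinearMap_surjective (hα : 0 < α) : Function.Surjective (berLinearMap hα) := by
  intro F
  obtain ⟨g, hg, hF⟩ := BergmanSpace.exists_lap hα F
  -- Division by the multiplier. Its values for `ξ ≤ 0` are irrelevant because `g` vanishes there.
  set h : ℝ → ℂ := fun ξ =>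
    ((Real.sqrt (2 * Real.pi) * (2 * Real.pi * ξ) ^ α : ℝ) : ℂ)⁻¹ * g ξ with hh
  have h0 : ∀ ξ ≤ 0, h ξ = 0 := fun ξ hξ => by simp [hh, hg.eq_zero ξ hξ]
  have hs : berSymbol α h = g := by
    ext ξ
    rcases le_or_gt ξ 0 with hξ | hξ
    · rw [berSymbol, h0 ξ hξ, hg.eq_zero ξ hξ, mul_zero]
    have hx := Real.rpow_pos_of_pos (mul_pos two_pi_pos hξ) α
    have hc := mul_pos (Real.sqrt_pos.2 two_pi_pos) hx
    rw [berSymbol, hh, ← mul_assoc, mul_inv_cancel₀ (Complex.ofReal_ne_zero.2 hc.ne'), one_mul]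
  have hmeas : AEStronglyMeasurable h volume :=
    (by fun_prop : Measurable fun ξ : ℝ =>
      ((Real.sqrt (2 * Real.pi) * (2 * Real.pi * ξ) ^ α : ℝ) : ℂ)⁻¹).aestronglyMeasurable.mul
      hg.aestronglyMeasurable
  have hm : MemLp h 2 volume := by
    refine ⟨hmeas, ?_⟩
    have h1 := F.2.2.2
    rw [hF, ← hs, eLpNorm_bergman_berSymbol hα h0 (hs ▸ hg)] at h1
    refine ENNReal.lt_top_of_mul_ne_top_right h1.ne (ENNReal.ofReal_pos.2 ?_).ne'
    exact Real.sqrt_pos.2 (berConst_pos hα)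
  have hL := isLaplaceL2_of_memLp h0 hm
  refine ⟨⟨fun z : ℍ => lap h z, hL.mdifferentiable_lap, ?_⟩, ?_⟩
  · rw [hL.hardyENorm_lap]
    exact hm.2
  · refine Subtype.ext ?_
    rw [hF, ← hs]
    exact funext (ber_eq_lap α hL hm rfl)

/-- The normalised Bergman transform as a linear isometry. -/
def berIsometry (hα : 0 < α) : HardySpace →ₗᵢ[ℂ] BergmanSpace (2 * α + 1) where
  toLinearMap := ((Real.sqrt (berConst α) : ℂ)⁻¹) • berLinearMap hα
  norm_map' f := by
    have hc := Real.sqrt_pos.2 (berConst_pos hα)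
    rw [LinearMap.smul_apply, norm_smul, norm_berLinearMap, norm_inv, Complex.norm_real,
      Real.norm_of_nonneg hc.le, inv_mul_cancel_left₀ hc.ne']

lemma berIsometry_surjective (hα : 0 < α) : Function.Surjective (berIsometry hα) := by
  intro F
  have hc := Real.sqrt_pos.2 (berConst_pos hα)
  obtain ⟨f, hf⟩ := berLinearMap_surjective hα ((Real.sqrt (berConst α) : ℂ) • F)
  refine ⟨f, ?_⟩
  change (Real.sqrt (berConst α) : ℂ)⁻¹ • berLinearMap hα f = F
  rw [hf, inv_smul_smul₀ (Complex.ofReal_ne_zero.2 hc.ne')]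

end

end BergmanTransform

end

theorem mainTheorem4 (α : ℝ) (hα : 0 < α) :
    (∀ f : BergmanTransform.HardySpace,
      Tendsto (BergmanTransform.sliceL2 f) BergmanTransform.heightToZero
        (𝓝 (BergmanTransform.boundary f))) ∧
    (∀ (f : BergmanTransform.HardySpace) (z : ℍ),
      IntegrableOn (BergmanTransform.berIntegrand α f z) (Set.Ioi (0 : ℝ))) ∧
    ∃ e : BergmanTransform.HardySpace ≃ₗᵢ[ℂ] BergmanTransform.BergmanSpace (2 * α + 1),
      ∀ (f : BergmanTransform.HardySpace) (z : ℍ),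
        BergmanTransform.Ber α f z =
          (Real.sqrt (2 * Real.pi * Real.Gamma (2 * α) / 4 ^ α) : ℂ) *
            (e f : ℍ → ℂ) z := by
  refine ⟨BergmanTransform.tendsto_boundary, BergmanTransform.integrableOn_berIntegrand hα,
    LinearIsometryEquiv.ofSurjective (BergmanTransform.berIsometry hα)
      (BergmanTransform.berIsometry_surjective hα), fun f z => ?_⟩
  have hc := Real.sqrt_pos.2 (BergmanTransform.berConst_pos hα)
  change BergmanTransform.Ber α f z = (Real.sqrt (BergmanTransform.berConst α) : ℂ) *
    ((Real.sqrt (BergmanTransform.berConst α) : ℂ)⁻¹ * BergmanTransform.Ber α f z)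
  rw [mul_inv_cancel_left₀ (Complex.ofReal_ne_zero.2 hc.ne')]
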